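/- Let $M$ be a smooth $n$-manifold, $G$ a (finite-dimensional) Lie group with Lie algebra $\mathfrak g$ and $G\to GL(n,\mathbb R)$ a smooth representation (classically, the inclusion of a Lie subgroup). A $G$-structure on $M$ is a smooth principal $G$-bundle $\pi:P\to M$ (right action) with a smooth $G$-equivariant map over $M$ to the frame bundle of $M$, $p\mapsto u_p:\mathbb R^n\xrightarrow{\sim}T_{\pi(p)}M$. Its tautological form is $\theta\in\Omega^1(P,\mathbb R^n)$, $\theta_p(X)=u_p^{-1}(d\pi(X))$; since $\ker\theta=\ker d\pi$, the pair $(P,\theta)$ is a Cartan $(G,\mathfrak g,\mathbb R^n)$-bundle (the case $l=0$, $\mathfrak h=\ker l=\mathfrak g$ of the general definitions below). *Definitions.* A Cartan $(G,\mathfrak h,V)$-bundle is a principal $G$-bundle $\pi:P\to M$ with a $G$-representation $V$, a map of representations $l:\mathfrak g\to V$ with kernel $\mathfrak h$, and a pointwise surjective $G$-equivariant form $\theta\in\Omega^1(P,V)$ such that $\theta(\alpha^\dagger)=l(\alpha)$ for the fundamental vector fields $\alpha^\dagger$, $\alpha\in\mathfrak g$, and $\ker\theta\subset\ker d\pi$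 is involutive. An almost Lie bracket is a bilinear skew-symmetric bracket (the Jacobi identity is not required). A Cartan-type extension is a short exact sequence of $G$-representations $0\to\mathfrak h\xrightarrow{i}\mathfrak z\xrightarrow{p}V\to0$ with an almost Lie bracket on $\mathfrak z$ such that $i$ preserves brackets. The Cartan bundle is $\mathfrak z$-flat if there is a $G$-equivariant $\eta\in\Omega^1(P,\mathfrak z)$ with $\eta(\alpha^\dagger)=i(\alpha)$ for $\alpha\in\mathfrak h$, $p\circ\eta=\theta$ and $d\eta+\tfrac12[\eta,\eta]_{\mathfrak z}=0$, where $\tfrac12[\eta,\eta](X,Y)=[\eta(X),\eta(Y)]$. Let $\mathfrak k$ be $\mathbb R^n$ with an almost Lie bracket $[\cdot,\cdot]_{\mathfrak k}$, and let $\mathfrak g\ltimes\mathfrak k$ be the Cartan-type extension $0\to\mathfrak g\to\mathfrak g\times\mathbb R^n\to\mathbb R^n\to0$ with the product of the adjoint representation and $\mathbb R^n$, and with the almost Lie bracket $$[(\alpha,v),(\beta,w)]=\bigl([\alpha,\beta]_{\mathfrak g},\ [v,w]_{\mathfrak k}+\alpha(w)-\beta(v)\bigr).$$ For a principal connection $\tau\in\Omega^1(P,\mathfrak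 g)$, its torsion function $T$ and curvature function $R$ assign to $p\in P$ skew-symmetric bilinear maps $T_p:\mathbb R^n\times\mathbb R^n\to\mathbb R^n$ and $R_p:\mathbb R^n\times\mathbb R^n\to\mathfrak g$: $T_p(v,w)$ and $R_p(v,w)$ are the values of $d\theta+\tau\wedge\theta$ and of $d\tau+\tfrac12[\tau,\tau]_{\mathfrak g}$ on the horizontal lifts of $v$ and $w$ at $p$ (the tangent vectors $X$ with $\tau(X)=0$ and $\theta(X)=v$, resp. $w$), where $(\tau\wedge\theta)(X,Y)=\tau(X)(\theta(Y))-\tau(Y)(\theta(X))$. These are the functions in the Cartan structure equations $d\theta=T(\theta\wedge\theta)-\tau\wedge\theta$, $d\tau=R(\theta\wedge\theta)-\tfrac12[\tau,\tau]_{\mathfrak g}$. **Theorem.** The $G$-structure $P$, viewed as the Cartan bundle $(P,\theta)$, is $(\mathfrak g\ltimes\mathfrak k)$-flat if and only if there exists a principal connection $\tau$ on $P$ such that * $R_p=0$ for all $p\in P$ (that is, $\tau$ is flat), and * $T_p(v,w)=-[v,w]_{\mathfrak k}$ for all $p\in P$ and all $v,w\in\mathbb R^n$. -/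

import Mathlib

open scoped Manifold ContDiff

noncomputable section

namespace CartanBundles

/-! Conventions.  All manifolds are smooth, finite dimensional and without boundary: a manifold is a
charted space over a finite dimensional normed space `E`, with the model `𝓘(ℝ, E)`.  The tangent
space `TangentSpace 𝓘(ℝ, E) x` is, by definition in Mathlib, a copy of `E`; in particular the Lie
algebra `T₁G` of a Lie group `G` modelled on `EG` is a copy of `EG`, and we write `EG` for it
whenever its norm is needed. -/

section LieGroups

variable (EG : Type*) [NormedAddCommGroup EG] [NormedSpace ℝ EG]
  (G : Type*) [TopologicalSpace G] [ChartedSpace EG G] [Group G]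

/-- The bracket of the Lie algebra `𝔤 = T₁G`, defined through left invariant vector fields. -/
def lieBr (α β : EG) : EG :=
  VectorField.mlieBracket 𝓘(ℝ, EG) (mulInvariantVectorField (I := 𝓘(ℝ, EG)) (G := G) α)
    (mulInvariantVectorField (I := 𝓘(ℝ, EG)) (G := G) β) 1

theorem lieBr_eq (α β : GroupLieAlgebra 𝓘(ℝ, EG) G) : lieBr EG G α β = ⁅α, β⁆ := rfl

variable {EG G} in
/-- The adjoint action of `g`: the differential at `1` of `x ↦ g x g⁻¹`. -/
def adj (g : G) : EG →L[ℝ] EG :=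
  mfderiv 𝓘(ℝ, EG) 𝓘(ℝ, EG) (fun x : G => g * x * g⁻¹) 1

/-- A smooth representation of the Lie group `G` on a finite dimensional real vector space. -/
structure LieRep (V : Type*) [NormedAddCommGroup V] [NormedSpace ℝ V] where
  ρ : G →* (V →L[ℝ] V)
  smooth : ContMDiff 𝓘(ℝ, EG) 𝓘(ℝ, V →L[ℝ] V) ∞ (fun g => ρ g)

variable {EG G} in
/-- The infinitesimal representation `𝔤 → 𝔤𝔩(V)`. -/
def LieRep.inf {V : Type*} [NormedAddCommGroup V] [NormedSpace ℝ V] (r : LieRep EG G V) :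
    EG →L[ℝ] (V →L[ℝ] V) :=
  mfderiv 𝓘(ℝ, EG) 𝓘(ℝ, V →L[ℝ] V) (fun g => r.ρ g) 1

theorem adj_one : (adj (1 : G) : EG →L[ℝ] EG) = ContinuousLinearMap.id ℝ EG := by
  unfold adj
  have : (fun x : G => 1 * x * 1⁻¹) = id := by ext x; simp
  rw [this]
  exact mfderiv_id

variable [LieGroup 𝓘(ℝ, EG) ∞ G]

theorem contMDiff_conj :
    ContMDiff (𝓘(ℝ, EG).prod 𝓘(ℝ, EG)) 𝓘(ℝ, EG) ∞ (fun q : G × G => q.1 * q.2 * q.1⁻¹) :=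
  (contMDiff_fst.mul contMDiff_snd).mul contMDiff_fst.inv

theorem contMDiff_conj_left (g : G) :
    ContMDiff 𝓘(ℝ, EG) 𝓘(ℝ, EG) ∞ (fun x : G => g * x * g⁻¹) :=
  (contMDiff_const.mul contMDiff_id).mul contMDiff_const

theorem adj_mul (g h : G) : (adj (g * h) : EG →L[ℝ] EG) = (adj g).comp (adj h) := by
  have e : (fun x : G => g * h * x * (g * h)⁻¹) =
      (fun x : G => g * x * g⁻¹) ∘ (fun x : G => h * x * h⁻¹) := by
    ext x; simp [mul_assoc]
  have h1 : h * 1 * h⁻¹ = 1 := by simp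
  have := mfderiv_comp (I := 𝓘(ℝ, EG)) (I' := 𝓘(ℝ, EG)) (I'' := 𝓘(ℝ, EG)) (1 : G)
    ((contMDiff_conj_left EG G g).mdifferentiable (by simp) (h * 1 * h⁻¹))
    ((contMDiff_conj_left EG G h).mdifferentiable (by simp) 1)
  unfold adj
  rw [e, this]
  rw [h1]
  rfl

theorem adj_smooth :
    ContMDiff 𝓘(ℝ, EG) 𝓘(ℝ, EG →L[ℝ] EG) ∞ (fun g : G => (adj g : EG →L[ℝ] EG)) := by
  intro g₀
  have := ContMDiffAt.mfderiv (I := 𝓘(ℝ, EG)) (I' := 𝓘(ℝ, EG)) (J := 𝓘(ℝ, EG)) (x₀ := g₀) (m := ∞)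
    (n := ∞) (fun g x : G => g * x * g⁻¹) (fun _ => (1 : G))
    ((contMDiff_conj EG G) (g₀, 1)) contMDiffAt_const (by simp)
  refine this.congr_of_eventuallyEq (Filter.Eventually.of_forall fun g => ?_)
  have h1 : g * 1 * g⁻¹ = g₀ * 1 * g₀⁻¹ := by simp
  have e := inTangentCoordinates_eq (I := 𝓘(ℝ, EG)) (I' := 𝓘(ℝ, EG)) (M := G) (M' := G) (N := G)
    (fun _ => 1) (fun g => g * 1 * g⁻¹) (fun g => (adj g : EG →L[ℝ] EG)) (x₀ := g₀) (x := g)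
    (by simp) (by rw [h1]; simp)
  have key : ∀ (y y' : G), y = y' → ∀ w : EG,
      (tangentBundleCore 𝓘(ℝ, EG) G).coordChange (achart EG y) (achart EG y') y w = w := by
    rintro y _ rfl w
    exact (tangentBundleCore 𝓘(ℝ, EG) G).coordChange_self _ _ (by simp) w
  refine Eq.trans ?_ e.symm
  ext v
  exact ((key _ _ h1 _).trans (congrArg _ (key _ _ rfl v))).symm

variable {EG G} in
/-- The adjoint representation. -/
def adjRep : LieRep EG G EG where
  ρ := { toFun := adj, map_one' := adj_one EG G, map_mul' := adj_mul EG G }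
  smooth := adj_smooth EG G

end LieGroups

section AlmostLie

/-- An almost Lie bracket: bilinear and skew-symmetric, the Jacobi identity is not required. -/
structure AlmostLieBracket (Z : Type*) [AddCommGroup Z] [Module ℝ Z] where
  br : Z →ₗ[ℝ] Z →ₗ[ℝ] Z
  br_self : ∀ z, br z z = 0

variable (EG : Type*) [NormedAddCommGroup EG] [NormedSpace ℝ EG] [FiniteDimensional ℝ EG]
  (G : Type*) [TopologicalSpace G] [ChartedSpace EG G] [Group G] [LieGroup 𝓘(ℝ, EG) ∞ G]

/-- The Lie algebra `𝔤` of `G`. -/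
def lieAlg : AlmostLieBracket EG :=
  haveI : LieGroup 𝓘(ℝ, EG) (minSmoothness ℝ 3) G := by
    rw [minSmoothness_of_isRCLikeNormedField]; infer_instance
  haveI : CompleteSpace EG := FiniteDimensional.complete ℝ EG
  { br := LinearMap.mk₂ ℝ (lieBr EG G)
      (fun a b c => add_lie (L := GroupLieAlgebra 𝓘(ℝ, EG) G) (M := GroupLieAlgebra 𝓘(ℝ, EG) G) a b c)
      (fun t a b => smul_lie (R := ℝ) (L := GroupLieAlgebra 𝓘(ℝ, EG) G) (M := GroupLieAlgebra 𝓘(ℝ, EG) G) t a b)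
      (fun a b c => lie_add (L := GroupLieAlgebra 𝓘(ℝ, EG) G) (M := GroupLieAlgebra 𝓘(ℝ, EG) G) a b c)
      (fun t a b => lie_smul (R := ℝ) (L := GroupLieAlgebra 𝓘(ℝ, EG) G) (M := GroupLieAlgebra 𝓘(ℝ, EG) G) t a b)
    br_self := fun a => lie_self (L := GroupLieAlgebra 𝓘(ℝ, EG) G) a }

variable {EG G}

/-- The semidirect product `𝔤 ⋉ 𝔨` of the Lie algebra of `G` with an almost Lie algebra `𝔨` whose
underlying space carries a representation of `G`:
`[(α, v), (β, w)] = ([α, β], [v, w] + α(w) - β(v))`.  No compatibility between the action and the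
bracket of `𝔨` is required. -/
def semidirect {V : Type*} [NormedAddCommGroup V] [NormedSpace ℝ V] (r : LieRep EG G V)
    (k : AlmostLieBracket V) : AlmostLieBracket (EG × V) where
  br := LinearMap.mk₂ ℝ
    (fun a b => ((lieAlg EG G).br a.1 b.1, k.br a.2 b.2 + r.inf a.1 b.2 - r.inf b.1 a.2))
    (by intro a b c; ext <;> simp; abel)
    (by intro t a b; ext <;> simp [smul_add, smul_sub])
    (by intro a b c; ext <;> simp; abel)
    (by intro t a b; ext <;> simp [smul_add, smul_sub])
  br_self := by
    intro a
    ext <;> simp [(lieAlg EG G).br_self, k.br_self]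

end AlmostLie

section Forms

variable {EP : Type*} [NormedAddCommGroup EP] [NormedSpace ℝ EP]
  {P : Type*} [TopologicalSpace P] [ChartedSpace EP P]
  {Z : Type*} [NormedAddCommGroup Z] [NormedSpace ℝ Z]

variable (EP P Z) in
/-- Vector valued 1-forms (not necessarily smooth). -/
abbrev OneForm := (p : P) → (TangentSpace 𝓘(ℝ, EP) p →L[ℝ] Z)

/-- A 1-form is smooth if it is smooth as a function on the total space of the tangent bundle. -/
def SmoothForm [IsManifold 𝓘(ℝ, EP) ∞ P] (η : OneForm EP P Z) : Prop :=
  ContMDiff 𝓘(ℝ, EP).tangent 𝓘(ℝ, Z) ∞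
    (fun X : TangentBundle 𝓘(ℝ, EP) P => η X.proj X.snd)

/-- The expression of a 1-form in the preferred chart at `p`, i.e. its pullback by the inverse of
that chart. -/
def chartForm (η : OneForm EP P Z) (p : P) : EP → (EP →L[ℝ] Z) := fun x =>
  (η ((extChartAt 𝓘(ℝ, EP) p).symm x)).comp
    (mfderiv 𝓘(ℝ, EP) 𝓘(ℝ, EP) (extChartAt 𝓘(ℝ, EP) p).symm x)

/-- The exterior derivative of a 1-form, computed in the preferred chart `φ` at `p`:
`dη(X, Y) = D_X η(Y) - D_Y η(X)` there. -/
def extD (η : OneForm EP P Z) (p : P) (X Y : TangentSpace 𝓘(ℝ, EP) p) : Z :=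
  let φ := extChartAt 𝓘(ℝ, EP) p
  let x : EP := mfderiv 𝓘(ℝ, EP) 𝓘(ℝ, EP) φ p X
  let y : EP := mfderiv 𝓘(ℝ, EP) 𝓘(ℝ, EP) φ p Y
  fderiv ℝ (chartForm η p) (φ p) x y - fderiv ℝ (chartForm η p) (φ p) y x

/-- The curvature `dη + ½[η, η]` of a 1-form with values in an almost Lie algebra, where
`½[η, η](X, Y) = [η(X), η(Y)]`. -/
def curv (B : AlmostLieBracket Z) (η : OneForm EP P Z) (p : P) (X Y : TangentSpace 𝓘(ℝ, EP) p) :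
    Z :=
  extD η p X Y + B.br (η p X) (η p Y)

/-- The kernel of a 1-form is involutive: if two smooth local vector fields take values in it, so
does their Lie bracket. -/
def InvolutiveKer [IsManifold 𝓘(ℝ, EP) ∞ P] (η : OneForm EP P Z) : Prop :=
  ∀ (U : Set P) (X Y : (p : P) → TangentSpace 𝓘(ℝ, EP) p), IsOpen U →
    ContMDiffOn 𝓘(ℝ, EP) 𝓘(ℝ, EP).tangent ∞
      (fun p => (⟨p, X p⟩ : TangentBundle 𝓘(ℝ, EP) P)) U →
    ContMDiffOn 𝓘(ℝ, EP) 𝓘(ℝ, EP).tangent ∞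
      (fun p => (⟨p, Y p⟩ : TangentBundle 𝓘(ℝ, EP) P)) U →
    (∀ p ∈ U, η p (X p) = 0) → (∀ p ∈ U, η p (Y p) = 0) →
    ∀ p ∈ U, η p (VectorField.mlieBracket 𝓘(ℝ, EP) X Y p) = 0

end Forms

section Bundles

variable (EG : Type*) [NormedAddCommGroup EG] [NormedSpace ℝ EG]
  (G : Type*) [TopologicalSpace G] [ChartedSpace EG G] [Group G]
  (EP : Type*) [NormedAddCommGroup EP] [NormedSpace ℝ EP]
  (P : Type*) [TopologicalSpace P] [ChartedSpace EP P]
  (EM : Type*) [NormedAddCommGroup EM] [NormedSpace ℝ EM]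
  (M : Type*) [TopologicalSpace M] [ChartedSpace EM M]

/-- A smooth principal `G`-bundle `π : P → M` (right action, smooth equivariant local
trivializations). -/
structure PrincipalBundle where
  π : P → M
  act : P → G → P
  π_smooth : ContMDiff 𝓘(ℝ, EP) 𝓘(ℝ, EM) ∞ π
  act_smooth : ContMDiff (𝓘(ℝ, EP).prod 𝓘(ℝ, EG)) 𝓘(ℝ, EP) ∞ (fun q : P × G => act q.1 q.2)
  act_one : ∀ p, act p 1 = p
  act_mul : ∀ p g h, act p (g * h) = act (act p g) h
  π_act : ∀ p g, π (act p g) = π p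
  locally_trivial : ∀ x : M, ∃ e : Bundle.Trivialization G π, x ∈ e.baseSet ∧
    ContMDiffOn 𝓘(ℝ, EP) (𝓘(ℝ, EM).prod 𝓘(ℝ, EG)) ∞ e e.source ∧
    ContMDiffOn (𝓘(ℝ, EM).prod 𝓘(ℝ, EG)) 𝓘(ℝ, EP) ∞ e.toOpenPartialHomeomorph.symm e.target ∧
    ∀ p ∈ e.source, ∀ g : G, e (act p g) = ((e p).1, (e p).2 * g)

variable {EG G EP P EM M}

namespace PrincipalBundle

variable (Q : PrincipalBundle EG G EP P EM M)

/-- The fundamental vector field `α†` of `α ∈ 𝔤`: the velocity of `g ↦ p g` at `g = 1` in the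
direction `α`. -/
def fund (α : EG) (p : P) : TangentSpace 𝓘(ℝ, EP) p :=
  (mfderiv 𝓘(ℝ, EG) 𝓘(ℝ, EP) (fun g : G => Q.act p g) 1 : EG →L[ℝ] EP) α

/-- The differential of the right translation `p ↦ p g`. -/
def transl (g : G) (p : P) (X : TangentSpace 𝓘(ℝ, EP) p) : TangentSpace 𝓘(ℝ, EP) (Q.act p g) :=
  mfderiv 𝓘(ℝ, EP) 𝓘(ℝ, EP) (fun q => Q.act q g) p X

/-- `R_g^* η = g⁻¹ · η` for all `g`. -/
def Equivariant {Z : Type*} [NormedAddCommGroup Z] [NormedSpace ℝ Z] (r : LieRep EG G Z)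
    (η : OneForm EP P Z) : Prop :=
  ∀ (g : G) (p : P) (X : TangentSpace 𝓘(ℝ, EP) p),
    η (Q.act p g) (Q.transl g p X) = r.ρ g⁻¹ (η p X)

end PrincipalBundle

end Bundles

section Cartan

variable {EG : Type*} [NormedAddCommGroup EG] [NormedSpace ℝ EG]
  {G : Type*} [TopologicalSpace G] [ChartedSpace EG G] [Group G]
  {EP : Type*} [NormedAddCommGroup EP] [NormedSpace ℝ EP]
  {P : Type*} [TopologicalSpace P] [ChartedSpace EP P]
  {EM : Type*} [NormedAddCommGroup EM] [NormedSpace ℝ EM]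
  {M : Type*} [TopologicalSpace M] [ChartedSpace EM M]
  {V : Type*} [NormedAddCommGroup V] [NormedSpace ℝ V]
  {Z : Type*} [NormedAddCommGroup Z] [NormedSpace ℝ Z]

variable (EG G V) in
/-- A Pfaffian group `(G, 𝔥, V)`: a representation `V` of `G` and a map of representations
`l : 𝔤 → V`; the ideal `𝔥` is the kernel of `l`. -/
structure PfaffianGroup where
  rep : LieRep EG G V
  l : EG →ₗ[ℝ] V
  l_equivariant : ∀ (g : G) (α : EG), l (adj g α) = rep.ρ g (l α)

/-- The ideal `𝔥 = ker l` of `𝔤`. -/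
abbrev PfaffianGroup.h (F : PfaffianGroup EG G V) : Submodule ℝ EG := LinearMap.ker F.l

theorem PfaffianGroup.adj_mem (F : PfaffianGroup EG G V) (g : G) (α : F.h) :
    (adj g (α : EG) : EG) ∈ F.h := by
  have := F.l_equivariant g α
  rw [LinearMap.mem_ker, this, LinearMap.mem_ker.1 α.2, map_zero]

/-- A Cartan `(G, 𝔥, V)`-bundle structure on a principal `G`-bundle `π : P → M`. -/
structure CartanBundle [IsManifold 𝓘(ℝ, EP) ∞ P] (F : PfaffianGroup EG G V)
    (Q : PrincipalBundle EG G EP P EM M) where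
  θ : OneForm EP P V
  smooth : SmoothForm θ
  surjective : ∀ p, Function.Surjective (θ p)
  equivariant : Q.Equivariant F.rep θ
  θ_fund : ∀ (α : EG) (p : P), θ p (Q.fund α p) = F.l α
  ker_le_vertical : ∀ (p : P) (X : TangentSpace 𝓘(ℝ, EP) p), θ p X = 0 →
    mfderiv 𝓘(ℝ, EP) 𝓘(ℝ, EM) Q.π p X = 0
  involutive : InvolutiveKer θ

/-- A Cartan-type extension `𝔷` of `(G, 𝔥, V)`: a short exact sequence `0 → 𝔥 → 𝔷 → V → 0` of
representations of `G`, and an almost Lie bracket on `𝔷` such that `𝔥 → 𝔷` preserves brackets. -/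
structure CartanTypeExtension (F : PfaffianGroup EG G V) (Z : Type*) [NormedAddCommGroup Z]
    [NormedSpace ℝ Z] where
  rep : LieRep EG G Z
  i : F.h →ₗ[ℝ] Z
  p : Z →ₗ[ℝ] V
  i_injective : Function.Injective i
  p_surjective : Function.Surjective p
  exact : LinearMap.range i = LinearMap.ker p
  i_equivariant : ∀ (g : G) (α : F.h), i ⟨adj g (α : EG), F.adj_mem g α⟩ = rep.ρ g (i α)
  p_equivariant : ∀ (g : G) (z : Z), p (rep.ρ g z) = F.rep.ρ g (p z)
  bracket : AlmostLieBracket Z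
  /-- Here `γ` is the bracket of `α` and `β`, which belongs to the ideal `𝔥`. -/
  i_bracket : ∀ α β γ : F.h, (γ : EG) = lieBr EG G α β → i γ = bracket.br (i α) (i β)

/-- A `𝔷`-lift `η` of the form `θ` of a Cartan bundle.  (Exactness of `0 → 𝔥 → 𝔷 → V → 0` forces
`dim 𝔷 = dim P`.) -/
structure IsLift [IsManifold 𝓘(ℝ, EP) ∞ P] {F : PfaffianGroup EG G V}
    {Q : PrincipalBundle EG G EP P EM M} (C : CartanBundle F Q) (z : CartanTypeExtension F Z)
    (η : OneForm EP P Z) : Prop where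
  smooth : SmoothForm η
  equivariant : Q.Equivariant z.rep η
  η_fund : ∀ (α : F.h) (p : P), η p (Q.fund α p) = z.i α
  lifts : ∀ (p : P) (X : TangentSpace 𝓘(ℝ, EP) p), z.p (η p X) = C.θ p X

/-- A Cartan bundle is `𝔷`-flat if it admits a `𝔷`-lift with vanishing curvature. -/
def CartanBundle.IsFlat [IsManifold 𝓘(ℝ, EP) ∞ P] {F : PfaffianGroup EG G V}
    {Q : PrincipalBundle EG G EP P EM M} (C : CartanBundle F Q) (z : CartanTypeExtension F Z) :
    Prop :=
  ∃ η : OneForm EP P Z, IsLift C z η ∧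
    ∀ (p : P) (X Y : TangentSpace 𝓘(ℝ, EP) p), curv z.bracket η p X Y = 0

/-- A principal connection on a principal `G`-bundle, as a `𝔤`-valued 1-form. -/
structure PrincipalConnection [IsManifold 𝓘(ℝ, EP) ∞ P] [LieGroup 𝓘(ℝ, EG) ∞ G]
    (Q : PrincipalBundle EG G EP P EM M) where
  τ : OneForm EP P EG
  smooth : SmoothForm τ
  τ_fund : ∀ (α : EG) (p : P), τ p (Q.fund α p) = α
  equivariant : Q.Equivariant adjRep τ

end Cartan

section RelatedFields

theorem fderiv_lieBracket_eq_zero {E F : Type*} [NormedAddCommGroup E] [NormedSpace ℝ E]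
    [NormedAddCommGroup F] [NormedSpace ℝ F] {f : E → F} {x : E} (hf : ContDiffAt ℝ 2 f x)
    {V W : E → E} (hV : DifferentiableAt ℝ V x) (hW : DifferentiableAt ℝ W x)
    (hV0 : ∀ᶠ y in nhds x, fderiv ℝ f y (V y) = 0)
    (hW0 : ∀ᶠ y in nhds x, fderiv ℝ f y (W y) = 0) :
    fderiv ℝ f x (VectorField.lieBracket ℝ V W x) = 0 := by
  have hd : DifferentiableAt ℝ (fderiv ℝ f) x :=
    (hf.fderiv_right (m := 1) (by norm_num)).differentiableAt (by simp)
  have key : ∀ {W : E → E}, DifferentiableAt ℝ W x → (∀ᶠ y in nhds x, fderiv ℝ f y (W y) = 0) →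
      ∀ v, fderiv ℝ (fderiv ℝ f) x v (W x) + fderiv ℝ f x (fderiv ℝ W x v) = 0 := by
    intro W hW hW0 v
    have h1 : HasFDerivAt (fun y => fderiv ℝ f y (W y)) (0 : E →L[ℝ] F) x :=
      (hasFDerivAt_const (0 : F) x).congr_of_eventuallyEq hW0
    have h2 := hd.hasFDerivAt.clm_apply hW.hasFDerivAt
    have h3 := congrArg (fun L => L v) (h2.unique h1)
    simp at h3
    rw [add_comm]; exact h3
  have hs := hf.isSymmSndFDerivAt (by simp) (V x) (W x)
  have e1 := key hW hW0 (V x)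
  have e2 := key hV hV0 (W x)
  rw [VectorField.lieBracket, map_sub, sub_eq_zero]
  rw [hs] at e1
  exact add_left_cancel (e1.trans e2.symm)

variable {EP : Type*} [NormedAddCommGroup EP] [NormedSpace ℝ EP] [FiniteDimensional ℝ EP]
  {P : Type*} [TopologicalSpace P] [ChartedSpace EP P] [IsManifold 𝓘(ℝ, EP) ∞ P]
  {EM : Type*} [NormedAddCommGroup EM] [NormedSpace ℝ EM]
  {M : Type*} [TopologicalSpace M] [ChartedSpace EM M] [IsManifold 𝓘(ℝ, EM) ∞ M]

theorem mfderiv_mlieBracket_eq_zero {f : P → M} (hf : ContMDiff 𝓘(ℝ, EP) 𝓘(ℝ, EM) ∞ f)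
    {U : Set P} (hU : IsOpen U) {X Y : (p : P) → TangentSpace 𝓘(ℝ, EP) p}
    (hX : ContMDiffOn 𝓘(ℝ, EP) 𝓘(ℝ, EP).tangent ∞
      (fun p => (⟨p, X p⟩ : TangentBundle 𝓘(ℝ, EP) P)) U)
    (hY : ContMDiffOn 𝓘(ℝ, EP) 𝓘(ℝ, EP).tangent ∞
      (fun p => (⟨p, Y p⟩ : TangentBundle 𝓘(ℝ, EP) P)) U)
    (hX0 : ∀ p ∈ U, mfderiv 𝓘(ℝ, EP) 𝓘(ℝ, EM) f p (X p) = 0)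
    (hY0 : ∀ p ∈ U, mfderiv 𝓘(ℝ, EP) 𝓘(ℝ, EM) f p (Y p) = 0) {p : P} (hp : p ∈ U) :
    mfderiv 𝓘(ℝ, EP) 𝓘(ℝ, EM) f p (VectorField.mlieBracket 𝓘(ℝ, EP) X Y p) = 0 := by
  have : CompleteSpace EP := FiniteDimensional.complete ℝ EP
  have : IsManifold 𝓘(ℝ, EP) 2 P := inferInstance
  set φ := extChartAt 𝓘(ℝ, EP) p with hφ
  set ψ := extChartAt 𝓘(ℝ, EM) (f p) with hψ
  let F : EP → EM := fun x => ψ (f (φ.symm x))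
  have hpφ : φ.symm (φ p) = p := extChartAt_to_inv p
  have htgt : φ.target ∈ nhds (φ p) := extChartAt_target_mem_nhds p
  have hcont : ContinuousAt φ.symm (φ p) := continuousAt_extChartAt_symm p
  have hUn : ∀ᶠ x in nhds (φ p), φ.symm x ∈ U :=
    hcont.eventually (by rw [hpφ]; exact hU.mem_nhds hp)
  have hψn : ∀ᶠ x in nhds (φ p), f (φ.symm x) ∈ (chartAt EM (f p)).source := by
    refine (hf.continuous.continuousAt.comp hcont).eventually ?_
    simp only [Function.comp_apply]
    rw [hpφ]
    exact (chartAt EM (f p)).open_source.mem_nhds (mem_chart_source EM (f p))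
  have hF : ContDiffAt ℝ 2 F (φ p) := by
    have := (contMDiffAt_iff.1 (hf p)).2
    rw [modelWithCornersSelf_coe, Set.range_id] at this
    exact (contDiffWithinAt_univ.1 this).of_le (by exact ENat.LEInfty.out)
  -- the local representatives of a vector field
  let R : ((p : P) → TangentSpace 𝓘(ℝ, EP) p) → EP → EP := fun X =>
    VectorField.mpullbackWithin 𝓘(ℝ, EP) 𝓘(ℝ, EP) φ.symm X Set.univ
  have hchain : ∀ᶠ x in nhds (φ p), ∀ v : EP, (fderiv ℝ F x v : EM) =
      mfderiv 𝓘(ℝ, EM) 𝓘(ℝ, EM) ψ (f (φ.symm x)) (mfderiv 𝓘(ℝ, EP) 𝓘(ℝ, EM) f (φ.symm x)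
        (mfderivWithin 𝓘(ℝ, EP) 𝓘(ℝ, EP) φ.symm Set.univ x v)) := by
    filter_upwards [htgt, hψn] with x hx hxψ v
    have h1 : MDifferentiableAt 𝓘(ℝ, EP) 𝓘(ℝ, EP) φ.symm x := by
      have := mdifferentiableWithinAt_extChartAt_symm (I := 𝓘(ℝ, EP)) hx
      rw [modelWithCornersSelf_coe, Set.range_id] at this
      exact mdifferentiableWithinAt_univ.1 this
    have h2 : MDifferentiableAt 𝓘(ℝ, EP) 𝓘(ℝ, EM) f (φ.symm x) := hf.mdifferentiable (by simp) _
    have h3 : MDifferentiableAt 𝓘(ℝ, EM) 𝓘(ℝ, EM) ψ (f (φ.symm x)) := mdifferentiableAt_extChartAt hxψ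
    let d1 : EP →L[ℝ] EP := mfderiv 𝓘(ℝ, EP) 𝓘(ℝ, EP) φ.symm x
    let d2 : EP →L[ℝ] EM := mfderiv 𝓘(ℝ, EP) 𝓘(ℝ, EM) f (φ.symm x)
    let d3 : EM →L[ℝ] EM := mfderiv 𝓘(ℝ, EM) 𝓘(ℝ, EM) ψ (f (φ.symm x))
    have h4 : HasMFDerivAt 𝓘(ℝ, EP) 𝓘(ℝ, EM) F x ((d3.comp d2).comp d1) :=
      (h3.hasMFDerivAt.comp (φ.symm x) h2.hasMFDerivAt).comp x h1.hasMFDerivAt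
    have h5 : HasFDerivAt F ((d3.comp d2).comp d1) x := hasMFDerivAt_iff_hasFDerivAt.1 h4
    rw [h5.fderiv, mfderivWithin_univ]
    rfl
  have hFX : ∀ X : (p : P) → TangentSpace 𝓘(ℝ, EP) p,
      (∀ p ∈ U, mfderiv 𝓘(ℝ, EP) 𝓘(ℝ, EM) f p (X p) = 0) →
      ∀ᶠ x in nhds (φ p), fderiv ℝ F x (R X x) = 0 := by
    intro X hX0
    filter_upwards [htgt, hUn, hchain] with x hx hxU hc
    rw [hc]
    have hinv := isInvertible_mfderivWithin_extChartAt_symm (I := 𝓘(ℝ, EP)) hx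
    rw [modelWithCornersSelf_coe, Set.range_id] at hinv
    have h6 : mfderivWithin 𝓘(ℝ, EP) 𝓘(ℝ, EP) φ.symm Set.univ x (R X x) =
        X (φ.symm x) := hinv.self_apply_inverse _
    rw [h6, hX0 _ hxU, map_zero]
    rfl
  have hRd : ∀ X : (p : P) → TangentSpace 𝓘(ℝ, EP) p,
      ContMDiffOn 𝓘(ℝ, EP) 𝓘(ℝ, EP).tangent ∞
        (fun p => (⟨p, X p⟩ : TangentBundle 𝓘(ℝ, EP) P)) U →
      DifferentiableAt ℝ (R X) (φ p) := by
    intro X hX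
    have h1 := ((hX.contMDiffAt (hU.mem_nhds hp)).mdifferentiableAt (by simp))
    have h2 := MDifferentiableWithinAt.differentiableWithinAt_mpullbackWithin_vectorField
      (mdifferentiableWithinAt_univ.2 h1)
    rw [modelWithCornersSelf_coe, Set.range_id, Set.preimage_univ, Set.univ_inter] at h2
    exact differentiableWithinAt_univ.1 h2
  have main := fderiv_lieBracket_eq_zero hF (hRd X hX) (hRd Y hY) (hFX X hX0) (hFX Y hY0)
  set B : EP := VectorField.lieBracket ℝ (R X) (R Y) (φ p) with hB
  rw [hchain.self_of_nhds] at main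
  have hcomp := mfderivWithin_extChartAt_symm_comp_mfderiv_extChartAt' (I := 𝓘(ℝ, EP))
    (mem_extChartAt_source (I := 𝓘(ℝ, EP)) p)
  have hinvφ := isInvertible_mfderiv_extChartAt (I := 𝓘(ℝ, EP))
    (mem_extChartAt_source (I := 𝓘(ℝ, EP)) p)
  rw [modelWithCornersSelf_coe, Set.range_id] at hcomp
  have hb0 : VectorField.mlieBracket 𝓘(ℝ, EP) X Y p =
      (mfderiv 𝓘(ℝ, EP) 𝓘(ℝ, EP) φ p).inverse B := by
    rw [← VectorField.mlieBracketWithin_univ, VectorField.mlieBracketWithin_apply]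
    rw [modelWithCornersSelf_coe, Set.range_id, Set.preimage_univ, Set.univ_inter]
    exact congrArg (mfderiv 𝓘(ℝ, EP) 𝓘(ℝ, EP) φ p).inverse
      (congrFun (VectorField.lieBracketWithin_univ (𝕜 := ℝ) (V := R X) (W := R Y)) (φ p))
  have hb : mfderivWithin 𝓘(ℝ, EP) 𝓘(ℝ, EP) φ.symm Set.univ (φ p) B =
      VectorField.mlieBracket 𝓘(ℝ, EP) X Y p := by
    rw [hb0]
    obtain ⟨Y', hY'⟩ := hinvφ.surjective B
    rw [← hY', hinvφ.inverse_apply_self]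
    exact congrArg (fun L => L Y') hcomp
  have hinj : Function.Injective (mfderiv 𝓘(ℝ, EM) 𝓘(ℝ, EM) ψ (f p)) :=
    (isInvertible_mfderiv_extChartAt (mem_extChartAt_source (f p))).injective
  have transfer : ∀ q : P, q = p → ∀ w : EP,
      (mfderiv 𝓘(ℝ, EM) 𝓘(ℝ, EM) ψ (f q) (mfderiv 𝓘(ℝ, EP) 𝓘(ℝ, EM) f q w) : EM) = 0 →
      mfderiv 𝓘(ℝ, EP) 𝓘(ℝ, EM) f p w = 0 := by
    rintro _ rfl w hw
    exact hinj (hw.trans (map_zero _).symm)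
  rw [← hb]
  exact transfer _ hpφ _ main

end RelatedFields

section GStructures

variable {n : ℕ}
  {EG : Type*} [NormedAddCommGroup EG] [NormedSpace ℝ EG]
  {G : Type*} [TopologicalSpace G] [ChartedSpace EG G] [Group G]
  {M : Type*} [TopologicalSpace M] [ChartedSpace (EuclideanSpace ℝ (Fin n)) M]

/-- A `G`-structure on the `n`-manifold `M`, for a representation `r` of the Lie group `G` on `ℝⁿ`
(the classical case is the inclusion of a Lie subgroup of `GL(n, ℝ)`): a principal `G`-bundle
`P → M` with a smooth `G`-equivariant map over `M` to the frame bundle of `M`.  The frame of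
`T_{π(p)}M` given by `p` is a linear isomorphism `u_p : ℝⁿ → T_{π(p)}M`; smoothness is that of
`p ↦ u_p` as a map to the total space of `Hom(ℝⁿ, TM)`, of which the frame bundle is an open
subset. -/
structure GStructure (r : LieRep EG G (EuclideanSpace ℝ (Fin n)))
    (EP : Type*) [NormedAddCommGroup EP] [NormedSpace ℝ EP]
    (P : Type*) [TopologicalSpace P] [ChartedSpace EP P]
    (M : Type*) [TopologicalSpace M] [ChartedSpace (EuclideanSpace ℝ (Fin n)) M] [IsManifold 𝓘(ℝ, EuclideanSpace ℝ (Fin n)) ∞ M] where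
  Q : PrincipalBundle EG G EP P (EuclideanSpace ℝ (Fin n)) M
  frame : (p : P) → (EuclideanSpace ℝ (Fin n)) ≃L[ℝ] TangentSpace 𝓘(ℝ, EuclideanSpace ℝ (Fin n)) (Q.π p)
  frame_smooth : ContMDiff 𝓘(ℝ, EP) (𝓘(ℝ, EuclideanSpace ℝ (Fin n)).prod 𝓘(ℝ, (EuclideanSpace ℝ (Fin n)) →L[ℝ] (EuclideanSpace ℝ (Fin n)))) ∞
    (fun p => (⟨Q.π p, (frame p : (EuclideanSpace ℝ (Fin n)) →L[ℝ] TangentSpace 𝓘(ℝ, EuclideanSpace ℝ (Fin n)) (Q.π p))⟩ :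
      Bundle.TotalSpace ((EuclideanSpace ℝ (Fin n)) →L[ℝ] (EuclideanSpace ℝ (Fin n)))
        (fun x : M => Bundle.Trivial M (EuclideanSpace ℝ (Fin n)) x →L[ℝ] TangentSpace 𝓘(ℝ, EuclideanSpace ℝ (Fin n)) x)))
  frame_equivariant : ∀ (p : P) (g : G) (v : EuclideanSpace ℝ (Fin n)),
    (frame (Q.act p g) v : EuclideanSpace ℝ (Fin n)) = frame p (r.ρ g v)

/-- The product of the adjoint representation with a representation `V`. -/
def prodRep [LieGroup 𝓘(ℝ, EG) ∞ G] [FiniteDimensional ℝ EG]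
    {V : Type*} [NormedAddCommGroup V] [NormedSpace ℝ V] (r : LieRep EG G V) :
    LieRep EG G (EG × V) where
  ρ :=
    { toFun := fun g => (adj g).prodMap (r.ρ g)
      map_one' := by
        rw [adj_one, map_one]; rfl
      map_mul' := fun g h => by
        rw [adj_mul, map_mul]; rfl }
  smooth :=
    (adj_smooth EG G).clm_prodMap r.smooth

namespace GStructure

variable {r : LieRep EG G (EuclideanSpace ℝ (Fin n))}
  {EP : Type*} [NormedAddCommGroup EP] [NormedSpace ℝ EP]
  {P : Type*} [TopologicalSpace P] [ChartedSpace EP P]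
  [IsManifold 𝓘(ℝ, EuclideanSpace ℝ (Fin n)) ∞ M] (S : GStructure r EP P M)

/-- The tautological form: `θ_p(X)` is the coordinate vector of `dπ(X)` in the frame `p`. -/
def θ : OneForm EP P (EuclideanSpace ℝ (Fin n)) := fun p =>
  ((S.frame p).symm : TangentSpace 𝓘(ℝ, EuclideanSpace ℝ (Fin n)) (S.Q.π p) →L[ℝ] (EuclideanSpace ℝ (Fin n))).comp
    (mfderiv 𝓘(ℝ, EP) 𝓘(ℝ, EuclideanSpace ℝ (Fin n)) S.Q.π p)

theorem θ_apply (p : P) (X : TangentSpace 𝓘(ℝ, EP) p) :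
    S.θ p X = (S.frame p).symm (mfderiv 𝓘(ℝ, EP) 𝓘(ℝ, EuclideanSpace ℝ (Fin n)) S.Q.π p X) := rfl

theorem θ_eq_zero_iff (p : P) (X : TangentSpace 𝓘(ℝ, EP) p) :
    S.θ p X = 0 ↔ mfderiv 𝓘(ℝ, EP) 𝓘(ℝ, EuclideanSpace ℝ (Fin n)) S.Q.π p X = 0 := by
  rw [θ_apply]
  exact (S.frame p).symm.map_eq_zero_iff

theorem θ_smooth [IsManifold 𝓘(ℝ, EP) ∞ P] : SmoothForm S.θ := by
  intro X₀
  set p₀ : P := X₀.proj with hp₀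
  set x₀ : M := S.Q.π p₀ with hx₀
  set e := trivializationAt (EuclideanSpace ℝ (Fin n)) (TangentSpace 𝓘(ℝ, EuclideanSpace ℝ (Fin n)) : M → Type _) x₀ with he
  let A : P → ((EuclideanSpace ℝ (Fin n)) →L[ℝ] (EuclideanSpace ℝ (Fin n))) := fun p =>
    ContinuousLinearMap.inCoordinates (EuclideanSpace ℝ (Fin n)) (Bundle.Trivial M (EuclideanSpace ℝ (Fin n))) (EuclideanSpace ℝ (Fin n))
      (TangentSpace 𝓘(ℝ, EuclideanSpace ℝ (Fin n)) : M → Type _) x₀ (S.Q.π p) x₀ (S.Q.π p)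
      (S.frame p : (EuclideanSpace ℝ (Fin n)) →L[ℝ] TangentSpace 𝓘(ℝ, EuclideanSpace ℝ (Fin n)) (S.Q.π p))
  have hA : ContMDiffAt 𝓘(ℝ, EP) 𝓘(ℝ, (EuclideanSpace ℝ (Fin n)) →L[ℝ] (EuclideanSpace ℝ (Fin n))) ∞ A p₀ :=
    ((contMDiffAt_hom_bundle _).1 (S.frame_smooth p₀)).2
  have hAv : ∀ p, ∀ v : EuclideanSpace ℝ (Fin n), A p v = e.continuousLinearMapAt ℝ (S.Q.π p) (S.frame p v) := by
    intro p v
    change e.continuousLinearMapAt ℝ (S.Q.π p) (S.frame p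
      ((trivializationAt (EuclideanSpace ℝ (Fin n)) (Bundle.Trivial M (EuclideanSpace ℝ (Fin n))) x₀).symmL ℝ (S.Q.π p) v)) = _
    congr 2
    exact congrArg (fun L : (EuclideanSpace ℝ (Fin n)) →L[ℝ] (EuclideanSpace ℝ (Fin n)) => L v)
      (Bundle.Trivial.symmL_trivialization ℝ M (EuclideanSpace ℝ (Fin n)) (S.Q.π p))
  have hbase : ∀ᶠ p in nhds p₀, S.Q.π p ∈ e.baseSet :=
    S.Q.π_smooth.continuous.continuousAt.eventually
      (e.open_baseSet.mem_nhds (mem_baseSet_trivializationAt _ _ x₀))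
  have hAinv : ∀ p, S.Q.π p ∈ e.baseSet → (A p).IsInvertible := by
    intro p hp
    refine ⟨(S.frame p).trans (e.continuousLinearEquivAt ℝ (S.Q.π p) hp), ?_⟩
    ext1 v
    rw [hAv]
    exact congrFun (e.coe_continuousLinearEquivAt_eq (R := ℝ) hp) (S.frame p v)
  have hAi : ContMDiffAt 𝓘(ℝ, EP) 𝓘(ℝ, (EuclideanSpace ℝ (Fin n)) →L[ℝ] (EuclideanSpace ℝ (Fin n))) ∞ (fun p => (A p).inverse) p₀ :=
    ((hAinv p₀ hbase.self_of_nhds).contDiffAt_map_inverse.contMDiffAt).comp p₀ hA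
  have hT : ContMDiff 𝓘(ℝ, EP).tangent 𝓘(ℝ, EuclideanSpace ℝ (Fin n)).tangent ∞
      (tangentMap 𝓘(ℝ, EP) 𝓘(ℝ, EuclideanSpace ℝ (Fin n)) S.Q.π) := S.Q.π_smooth.contMDiff_tangentMap (by simp)
  have hB := (Bundle.contMDiffAt_totalSpace.1 (hT X₀)).2
  have hproj : ContMDiffAt 𝓘(ℝ, EP).tangent 𝓘(ℝ, EP) ∞
      (fun X : TangentBundle 𝓘(ℝ, EP) P => X.proj) X₀ := Bundle.contMDiffAt_proj _
  have hfin := (ContMDiffAt.comp X₀ hAi hproj).clm_apply hB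
  refine hfin.congr_of_eventuallyEq ?_
  filter_upwards [hproj.continuousAt.eventually hbase] with X hX
  have hi := hAinv X.proj hX
  refine Eq.symm (hi.inverse_apply_eq.2 ?_)
  rw [hAv]
  have h7 : S.frame X.proj (S.θ X.proj X.snd) =
      mfderiv 𝓘(ℝ, EP) 𝓘(ℝ, EuclideanSpace ℝ (Fin n)) S.Q.π X.proj X.snd := (S.frame X.proj).apply_symm_apply _
  rw [h7]
  exact (congrFun (e.coe_linearMapAt_of_mem (R := ℝ) hX) _).symm

theorem mfderiv_π_surjective [LieGroup 𝓘(ℝ, EG) ∞ G] [IsManifold 𝓘(ℝ, EP) ∞ P] (p : P) :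
    Function.Surjective (mfderiv 𝓘(ℝ, EP) 𝓘(ℝ, EuclideanSpace ℝ (Fin n)) S.Q.π p) := by
  obtain ⟨e, hx, h1, h2, -⟩ := S.Q.locally_trivial (S.Q.π p)
  have hp : p ∈ e.source := e.mem_source.2 hx
  have hd : e.toOpenPartialHomeomorph.MDifferentiable 𝓘(ℝ, EP) (𝓘(ℝ, EuclideanSpace ℝ (Fin n)).prod 𝓘(ℝ, EG)) :=
    ⟨h1.mdifferentiableOn (by simp), h2.mdifferentiableOn (by simp)⟩
  have hs := hd.mfderiv_surjective hp
  have heq : S.Q.π =ᶠ[nhds p] (Prod.fst ∘ e.toOpenPartialHomeomorph) := by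
    filter_upwards [e.open_source.mem_nhds hp] with q hq
    exact (e.proj_toFun q hq).symm
  intro w
  obtain ⟨X, hX⟩ := hs ((w, 0) : (EuclideanSpace ℝ (Fin n)) × EG)
  refine ⟨X, ?_⟩
  have hc : HasMFDerivAt 𝓘(ℝ, EP) 𝓘(ℝ, EuclideanSpace ℝ (Fin n)) (Prod.fst ∘ e.toOpenPartialHomeomorph) p _ :=
    (hasMFDerivAt_fst _).comp p (hd.mdifferentiableAt hp).hasMFDerivAt
  have hm := (hc.congr_of_eventuallyEq heq).mfderiv
  rw [hm]
  exact congrArg Prod.fst hX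

theorem θ_surjective [LieGroup 𝓘(ℝ, EG) ∞ G] [IsManifold 𝓘(ℝ, EP) ∞ P] (p : P) :
    Function.Surjective (S.θ p) :=
  (S.frame p).symm.surjective.comp (S.mfderiv_π_surjective p)

theorem θ_fund (α : EG) (p : P) : S.θ p (S.Q.fund α p) = 0 := by
  rw [θ_eq_zero_iff]
  have h1 : MDifferentiableAt 𝓘(ℝ, EG) 𝓘(ℝ, EP) (fun g : G => S.Q.act p g) 1 :=
    ((S.Q.act_smooth.comp (contMDiff_const.prodMk contMDiff_id)).mdifferentiable (by simp)) 1
  have h2 : MDifferentiableAt 𝓘(ℝ, EP) 𝓘(ℝ, EuclideanSpace ℝ (Fin n)) S.Q.π (S.Q.act p 1) :=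
    S.Q.π_smooth.mdifferentiable (by simp) _
  have h3 : S.Q.π ∘ (fun g : G => S.Q.act p g) = fun _ => S.Q.π p :=
    funext fun g => S.Q.π_act p g
  have h4 := mfderiv_comp (1 : G) h2 h1
  rw [h3, mfderiv_const] at h4
  have h5 : ∀ q : P, q = p →
      (mfderiv 𝓘(ℝ, EP) 𝓘(ℝ, EuclideanSpace ℝ (Fin n)) S.Q.π q (S.Q.fund α p) : EuclideanSpace ℝ (Fin n)) = 0 →
      mfderiv 𝓘(ℝ, EP) 𝓘(ℝ, EuclideanSpace ℝ (Fin n)) S.Q.π p (S.Q.fund α p) = 0 := by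
    rintro _ rfl h; exact h
  exact h5 _ (S.Q.act_one p) (congrArg (fun L : EG →L[ℝ] (EuclideanSpace ℝ (Fin n)) => L α) h4).symm

theorem θ_equivariant : S.Q.Equivariant r S.θ := by
  intro g p X
  have h1 : MDifferentiableAt 𝓘(ℝ, EP) 𝓘(ℝ, EP) (fun q : P => S.Q.act q g) p :=
    ((S.Q.act_smooth.comp (contMDiff_id.prodMk contMDiff_const)).mdifferentiable (by simp)) p
  have h2 : MDifferentiableAt 𝓘(ℝ, EP) 𝓘(ℝ, EuclideanSpace ℝ (Fin n)) S.Q.π (S.Q.act p g) :=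
    S.Q.π_smooth.mdifferentiable (by simp) _
  have h3 : S.Q.π ∘ (fun q : P => S.Q.act q g) = S.Q.π := funext fun q => S.Q.π_act q g
  have h4 := mfderiv_comp p h2 h1
  rw [h3] at h4
  have h5 : (mfderiv 𝓘(ℝ, EP) 𝓘(ℝ, EuclideanSpace ℝ (Fin n)) S.Q.π (S.Q.act p g) (S.Q.transl g p X) : EuclideanSpace ℝ (Fin n)) =
      mfderiv 𝓘(ℝ, EP) 𝓘(ℝ, EuclideanSpace ℝ (Fin n)) S.Q.π p X :=
    (congrArg (fun L : EP →L[ℝ] (EuclideanSpace ℝ (Fin n)) => L X) h4).symm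
  rw [θ_apply]
  apply (S.frame (S.Q.act p g)).injective
  refine ((S.frame (S.Q.act p g)).apply_symm_apply _).trans ?_
  refine Eq.trans ?_ (S.frame_equivariant p g _).symm
  have h6 : r.ρ g (r.ρ g⁻¹ (S.θ p X)) = S.θ p X := by
    rw [← mul_apply_eq_comp, ← map_mul]; simp
  rw [h6]
  exact h5.trans ((S.frame p).apply_symm_apply _).symm

theorem θ_involutive [FiniteDimensional ℝ EP] [IsManifold 𝓘(ℝ, EP) ∞ P] : InvolutiveKer S.θ := by
  intro U X Y hU hX hY hX0 hY0 p hp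
  simp only [θ_eq_zero_iff] at *
  exact mfderiv_mlieBracket_eq_zero S.Q.π_smooth hU hX hY hX0 hY0 hp

/-- The Pfaffian group `(G, 𝔤, ℝⁿ)` of a `G`-structure: `l = 0`, so that `𝔥 = 𝔤`. -/
def pfaffianGroup (r : LieRep EG G (EuclideanSpace ℝ (Fin n))) : PfaffianGroup EG G (EuclideanSpace ℝ (Fin n)) where
  rep := r
  l := 0
  l_equivariant := fun g _ => ((r.ρ g).map_zero).symm

/-- A `G`-structure, with its tautological form, as a Cartan bundle. -/
def toCartanBundle [LieGroup 𝓘(ℝ, EG) ∞ G] [FiniteDimensional ℝ EP] [IsManifold 𝓘(ℝ, EP) ∞ P] :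
    CartanBundle (pfaffianGroup r) S.Q where
  θ := S.θ
  smooth := S.θ_smooth
  surjective := S.θ_surjective
  equivariant := S.θ_equivariant
  θ_fund := S.θ_fund
  ker_le_vertical := fun p X h => (S.θ_eq_zero_iff p X).1 h
  involutive := S.θ_involutive

/-- The semidirect product `𝔤 ⋉ 𝔨`, where `𝔨` is `ℝⁿ` with an almost Lie bracket, as a Cartan-type
extension `0 → 𝔤 → 𝔤 ⋉ 𝔨 → ℝⁿ → 0`. -/
def semidirectExtension [LieGroup 𝓘(ℝ, EG) ∞ G] [FiniteDimensional ℝ EG]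
    (r : LieRep EG G (EuclideanSpace ℝ (Fin n))) (k : AlmostLieBracket (EuclideanSpace ℝ (Fin n))) :
    CartanTypeExtension (pfaffianGroup r) (EG × (EuclideanSpace ℝ (Fin n))) where
  rep := prodRep r
  i := (LinearMap.inl ℝ EG (EuclideanSpace ℝ (Fin n))).comp (pfaffianGroup r).h.subtype
  p := LinearMap.snd ℝ EG (EuclideanSpace ℝ (Fin n))
  i_injective := LinearMap.inl_injective.comp Subtype.val_injective
  p_surjective := LinearMap.snd_surjective
  exact := by
    ext z
    constructor
    · rintro ⟨α, rfl⟩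
      simp
    · intro hz
      refine ⟨⟨z.1, rfl⟩, ?_⟩
      have : z.2 = 0 := hz
      exact Prod.ext rfl this.symm
  i_equivariant := fun g _ => Prod.ext rfl ((r.ρ g).map_zero).symm
  p_equivariant := fun _ _ => rfl
  bracket := semidirect r k
  i_bracket := by
    intro α β γ h
    refine Prod.ext h ?_
    simp [semidirect]

variable [LieGroup 𝓘(ℝ, EG) ∞ G] [IsManifold 𝓘(ℝ, EP) ∞ P] (c : PrincipalConnection S.Q)

theorem exists_horizontalLift (p : P) (v : EuclideanSpace ℝ (Fin n)) :
    ∃ X : TangentSpace 𝓘(ℝ, EP) p, c.τ p X = 0 ∧ S.θ p X = v := by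
  obtain ⟨X, hX⟩ := S.θ_surjective p v
  refine ⟨X - S.Q.fund (c.τ p X) p, ?_, ?_⟩
  · rw [map_sub, c.τ_fund, sub_self]
  · rw [map_sub, S.θ_fund, sub_zero, hX]

/-- The horizontal lift of `v ∈ ℝⁿ` at `p`: the tangent vector `X` at `p` with `τ(X) = 0` and
`θ(X) = v`.  (It is unique: if `τ(X) = 0` and `θ(X) = 0`, then `X` is vertical, so `X = α†` at `p`
for some `α ∈ 𝔤`, and `α = τ(X) = 0`.) -/
def horizontalLift (p : P) (v : EuclideanSpace ℝ (Fin n)) : TangentSpace 𝓘(ℝ, EP) p :=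
  (S.exists_horizontalLift c p v).choose

/-- The 2-form `dθ + τ ∧ θ`, where `(τ ∧ θ)(X, Y) = τ(X)(θ(Y)) - τ(Y)(θ(X))`. -/
def torsionForm (p : P) (X Y : TangentSpace 𝓘(ℝ, EP) p) : EuclideanSpace ℝ (Fin n) :=
  extD S.θ p X Y + (r.inf (c.τ p X) (S.θ p Y) - r.inf (c.τ p Y) (S.θ p X))

/-- The torsion function `T` of a connection: the function with `dθ = T(θ ∧ θ) - τ ∧ θ`, i.e.
`T_p(v, w)` is the value of `dθ + τ ∧ θ` on the horizontal lifts of `v` and `w` at `p`. -/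
def torsion (p : P) (v w : EuclideanSpace ℝ (Fin n)) : EuclideanSpace ℝ (Fin n) :=
  S.torsionForm c p (S.horizontalLift c p v) (S.horizontalLift c p w)

/-- The curvature function `R` of a connection: the function with `dτ = R(θ ∧ θ) - ½[τ, τ]`, i.e.
`R_p(v, w)` is the value of `dτ + ½[τ, τ]` on the horizontal lifts of `v` and `w` at `p`. -/
def curvature [FiniteDimensional ℝ EG] (p : P) (v w : EuclideanSpace ℝ (Fin n)) : EG :=
  curv (lieAlg EG G) c.τ p (S.horizontalLift c p v) (S.horizontalLift c p w)

end GStructure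

end GStructures

end CartanBundles

end

/-!
Given a connection `τ`, the form `η = (τ, θ)` takes values in `𝔤 × ℝⁿ`, and conversely a
`(𝔤 ⋉ 𝔨)`-lift of `θ` is of this form, its first component being a principal connection.  The
curvature of `η` in `𝔤 ⋉ 𝔨` has the components `dτ + ½[τ, τ]` and `dθ + τ ∧ θ + [θ, θ]_𝔨`
(`GStructure.curv_coframe`), whose values on horizontal lifts are `R` and `T + [·, ·]_𝔨`.  So if `η`
is flat, then `R = 0` and `T = -[·, ·]_𝔨`.

For the converse the curvature of `η` has to vanish on all tangent vectors.  Since `η` is injective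
(`GStructure.coframe_injective`), every tangent vector is the sum of a fundamental vector and a
horizontal lift, so it remains to see that the curvature vanishes as soon as one argument is a
fundamental vector `α†` (`GStructure.curv_coframe_fund`).  Cartan's formula for the equivariant form
`η` gives `dη(α†, Y) = -α · η(Y)` (`PrincipalBundle.extD_fund`).  It is obtained by computing `dη`
along the action map `(g, q) ↦ q g`, which is legitimate because the exterior derivative commutes
with pullback (`extD_mfderiv`).  The action of `α` on `𝔤 × ℝⁿ` is the bracket with `(α, 0)` in
`𝔤 ⋉ 𝔨`, because the derivative of the adjoint representation is the bracket of left invariant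
vector fields (`adjRep_inf`); so the two terms of the curvature cancel.
-/

noncomputable section

namespace CartanBundles

/-! ### Exterior derivative, curvature and pullback -/

section ExteriorDerivative

variable {EP : Type*} [NormedAddCommGroup EP] [NormedSpace ℝ EP]
  {P : Type*} [TopologicalSpace P] [ChartedSpace EP P]
  {Z : Type*} [NormedAddCommGroup Z] [NormedSpace ℝ Z]
  {Z' : Type*} [NormedAddCommGroup Z'] [NormedSpace ℝ Z']
  {W : Type*} [NormedAddCommGroup W] [NormedSpace ℝ W]

/-- The pullback of a 1-form along a map `f` from a normed space `W` to the manifold, as a function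
on `W` with values in the continuous linear maps.  The form `chartForm η p` is the case where `f`
is the inverse of the preferred chart at `p`. -/
def pullbackForm (η : OneForm EP P Z) (f : W → P) : W → (W →L[ℝ] Z) := fun w =>
  (η (f w)).comp (mfderiv 𝓘(ℝ, W) 𝓘(ℝ, EP) f w)

theorem extD_swap (η : OneForm EP P Z) (p : P) (X Y : TangentSpace 𝓘(ℝ, EP) p) :
    extD η p X Y = -extD η p Y X := by
  simp only [extD, neg_sub]

theorem extD_add_left (η : OneForm EP P Z)
    (p : P) (X X' Y : TangentSpace 𝓘(ℝ, EP) p) :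
    extD η p (X + X') Y = extD η p X Y + extD η p X' Y := by
  simp only [extD]
  rw [map_add]
  set a : EP := mfderiv 𝓘(ℝ, EP) 𝓘(ℝ, EP) (extChartAt 𝓘(ℝ, EP) p) p X
  set b : EP := mfderiv 𝓘(ℝ, EP) 𝓘(ℝ, EP) (extChartAt 𝓘(ℝ, EP) p) p X'
  set c : EP := mfderiv 𝓘(ℝ, EP) 𝓘(ℝ, EP) (extChartAt 𝓘(ℝ, EP) p) p Y
  change fderiv ℝ (chartForm η p) _ (a + b) c - fderiv ℝ (chartForm η p) _ c (a + b) = _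
  rw [map_add, map_add, _root_.add_apply]
  abel

theorem AlmostLieBracket.br_swap {A : Type*} [AddCommGroup A] [Module ℝ A]
    (B : AlmostLieBracket A) (x y : A) : B.br x y = -B.br y x := by
  have h := B.br_self (x + y)
  simp only [map_add, LinearMap.add_apply, B.br_self, zero_add, add_zero] at h
  exact eq_neg_of_add_eq_zero_right h

section Curvature

variable (B : AlmostLieBracket Z) (η : OneForm EP P Z) (p : P)

theorem curv_swap (X Y : TangentSpace 𝓘(ℝ, EP) p) : curv B η p X Y = -curv B η p Y X := by
  simp only [curv]
  rw [extD_swap, B.br_swap, neg_add]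

theorem curv_add_left (X X' Y : TangentSpace 𝓘(ℝ, EP) p) :
    curv B η p (X + X') Y = curv B η p X Y + curv B η p X' Y := by
  simp only [curv]
  rw [extD_add_left, map_add, map_add, LinearMap.add_apply]
  abel

/-- If every tangent vector is the sum of a vertical part `V X` and of a horizontal part `H X`, and
the curvature vanishes on vertical vectors and on pairs of horizontal vectors, then it vanishes. -/
theorem curv_eq_zero_of_decomposition {V H : TangentSpace 𝓘(ℝ, EP) p → TangentSpace 𝓘(ℝ, EP) p}
    (hVH : ∀ X, V X + H X = X) (hV : ∀ X Y, curv B η p (V X) Y = 0)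
    (hH : ∀ X Y, curv B η p (H X) (H Y) = 0) (X Y : TangentSpace 𝓘(ℝ, EP) p) :
    curv B η p X Y = 0 := by
  rw [← hVH X, curv_add_left, hV, zero_add, curv_swap, ← hVH Y, curv_add_left, hV, zero_add, hH,
    neg_zero]

end Curvature

variable [IsManifold 𝓘(ℝ, EP) ∞ P]

theorem SmoothForm.clm_comp {η : OneForm EP P Z} (hη : SmoothForm η) (L : Z →L[ℝ] Z') :
    SmoothForm (fun p => L.comp (η p) : OneForm EP P Z') :=
  L.contMDiff.comp hη

theorem SmoothForm.prodMk {η : OneForm EP P Z} {ζ : OneForm EP P Z'} (hη : SmoothForm η)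
    (hζ : SmoothForm ζ) : SmoothForm (fun p => (η p).prod (ζ p) : OneForm EP P (Z × Z')) :=
  hη.prodMk_space hζ

/-- Smoothness on the tangent bundle gives smoothness of the coefficients of the form. -/
theorem SmoothForm.differentiableAt_pullbackForm [FiniteDimensional ℝ W] {η : OneForm EP P Z}
    (hη : SmoothForm η) {f : W → P} {U : Set W} (hU : IsOpen U)
    (hf : ContMDiffOn 𝓘(ℝ, W) 𝓘(ℝ, EP) ∞ f U) {w : W} (hw : w ∈ U) :
    DifferentiableAt ℝ (pullbackForm η f) w := by
  have key : ContDiffOn ℝ ∞ (pullbackForm η f) U := by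
    rw [contDiffOn_clm_apply]
    intro b
    have h1 : ContMDiffOn 𝓘(ℝ, W) 𝓘(ℝ, W).tangent ∞
        (fun w => (⟨w, b⟩ : TangentBundle 𝓘(ℝ, W) W)) U :=
      contMDiffOn_vectorSpace_iff_contDiffOn.2 contDiffOn_const
    have h2 := hf.contMDiffOn_tangentMapWithin (m := ∞) (by simp) hU.uniqueMDiffOn
    have h3 := h2.comp h1 (fun w hw => hw)
    refine contMDiffOn_iff_contDiffOn.1 ((hη.comp_contMDiffOn h3).congr fun w hw => ?_)
    simp only [pullbackForm, Function.comp_apply, tangentMapWithin]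
    rw [mfderivWithin_of_isOpen hU hw]
    rfl
  exact (key.contDiffAt (hU.mem_nhds hw)).differentiableAt (by simp)

theorem SmoothForm.differentiableAt_chartForm [FiniteDimensional ℝ EP] {η : OneForm EP P Z}
    (hη : SmoothForm η) (p : P) :
    DifferentiableAt ℝ (chartForm η p) (extChartAt 𝓘(ℝ, EP) p p) :=
  hη.differentiableAt_pullbackForm (isOpen_extChartAt_target p) (contMDiffOn_extChartAt_symm p)
    (mem_extChartAt_target p)

theorem extD_clm_comp [FiniteDimensional ℝ EP] {η : OneForm EP P Z} (hη : SmoothForm η)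
    (L : Z →L[ℝ] Z') (p : P) (X Y : TangentSpace 𝓘(ℝ, EP) p) :
    extD (fun p => L.comp (η p) : OneForm EP P Z') p X Y = L (extD η p X Y) := by
  have h : HasFDerivAt (chartForm (fun p => L.comp (η p) : OneForm EP P Z') p) _
      (extChartAt 𝓘(ℝ, EP) p p) :=
    ((ContinuousLinearMap.compL ℝ EP Z Z') L).hasFDerivAt.comp _
      (hη.differentiableAt_chartForm p).hasFDerivAt
  simp only [extD]
  rw [h.fderiv, map_sub]
  rfl

/-- The pullback form, read in the preferred chart at `f w₀`. -/
theorem pullbackForm_eventuallyEq (η : OneForm EP P Z) {f : W → P} {U : Set W} (hU : IsOpen U)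
    (hf : ContMDiffOn 𝓘(ℝ, W) 𝓘(ℝ, EP) ∞ f U) {w₀ : W} (hw : w₀ ∈ U) :
    pullbackForm η f =ᶠ[nhds w₀] fun w =>
      (chartForm η (f w₀) (extChartAt 𝓘(ℝ, EP) (f w₀) (f w))).comp
        (fderiv ℝ (fun w => extChartAt 𝓘(ℝ, EP) (f w₀) (f w)) w) := by
  set φ := extChartAt 𝓘(ℝ, EP) (f w₀) with hφ
  have hcont : ContinuousAt f w₀ := (hf.contMDiffAt (hU.mem_nhds hw)).continuousAt
  have hs : ∀ᶠ w in nhds w₀, f w ∈ φ.source :=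
    hcont.eventually (extChartAt_source_mem_nhds (I := 𝓘(ℝ, EP)) (f w₀))
  filter_upwards [hs.eventually_nhds, hU.mem_nhds hw] with w hw1 hwU
  have hw2 := hw1.self_of_nhds
  have hfw : MDifferentiableAt 𝓘(ℝ, W) 𝓘(ℝ, EP) f w :=
    (hf.contMDiffAt (hU.mem_nhds hwU)).mdifferentiableAt (by simp)
  have h3 : MDifferentiableAt 𝓘(ℝ, EP) 𝓘(ℝ, EP) φ (f w) :=
    mdifferentiableAt_extChartAt (by rwa [hφ, extChartAt_source] at hw2)
  have hg : MDifferentiableAt 𝓘(ℝ, W) 𝓘(ℝ, EP) (fun w => φ (f w)) w := h3.comp w hfw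
  have h1 : MDifferentiableAt 𝓘(ℝ, EP) 𝓘(ℝ, EP) φ.symm (φ (f w)) :=
    ((contMDiffOn_extChartAt_symm (n := ∞) (f w₀)).contMDiffAt
      ((isOpen_extChartAt_target (f w₀)).mem_nhds (φ.map_source hw2))).mdifferentiableAt (by simp)
  have he : (φ.symm ∘ fun w => φ (f w)) =ᶠ[nhds w] f := by
    filter_upwards [hw1] with x hx
    exact φ.left_inv hx
  have hc := (h1.hasMFDerivAt.comp w hg.hasMFDerivAt).congr_of_eventuallyEq he.symm
  have ht : ∀ q : P, q = f w → ∀ v : EP, (η q : EP →L[ℝ] Z) v = (η (f w) : EP →L[ℝ] Z) v := by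
    rintro _ rfl v; rfl
  refine ContinuousLinearMap.ext fun b => ?_
  rw [← mfderiv_eq_fderiv]
  refine Eq.trans ?_ (ht _ (φ.left_inv hw2) _).symm
  exact congrArg (fun T : W →L[ℝ] EP => (η (f w) : EP →L[ℝ] Z) (T b)) hc.mfderiv

/-- The exterior derivative commutes with pullback: it may be computed along any smooth map from a
normed space, instead of the inverse of the preferred chart. -/
theorem extD_mfderiv [FiniteDimensional ℝ EP] [FiniteDimensional ℝ W] {η : OneForm EP P Z}
    (hη : SmoothForm η) {f : W → P} {U : Set W} (hU : IsOpen U)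
    (hf : ContMDiffOn 𝓘(ℝ, W) 𝓘(ℝ, EP) ∞ f U) {w : W} (hw : w ∈ U) (a b : W) :
    extD η (f w) (mfderiv 𝓘(ℝ, W) 𝓘(ℝ, EP) f w a) (mfderiv 𝓘(ℝ, W) 𝓘(ℝ, EP) f w b) =
      fderiv ℝ (pullbackForm η f) w a b - fderiv ℝ (pullbackForm η f) w b a := by
  rw [(pullbackForm_eventuallyEq η hU hf hw).fderiv_eq]
  set φ := extChartAt 𝓘(ℝ, EP) (f w) with hφ
  set g : W → EP := fun x => φ (f x) with hgdef
  have hfw := hf.contMDiffAt (hU.mem_nhds hw)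
  have hg : ContDiffAt ℝ ∞ g w :=
    contMDiffAt_iff_contDiffAt.1 (contMDiffAt_extChartAt.comp w hfw)
  have hd : DifferentiableAt ℝ (fderiv ℝ g) w :=
    (hg.fderiv_right (m := 1) (by norm_cast)).differentiableAt (by simp)
  have hω : DifferentiableAt ℝ (chartForm η (f w)) (g w) := hη.differentiableAt_chartForm (f w)
  have hgd : HasFDerivAt g (fderiv ℝ g w) w := (hg.differentiableAt (by simp)).hasFDerivAt
  have hc := (hω.hasFDerivAt.comp w hgd).clm_comp hd.hasFDerivAt
  have hsymm := (hg.of_le (m := 2) (by exact ENat.LEInfty.out)).isSymmSndFDerivAt (by simp) a b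
  have hch : ∀ v : W, (mfderiv 𝓘(ℝ, EP) 𝓘(ℝ, EP) φ (f w)
      (mfderiv 𝓘(ℝ, W) 𝓘(ℝ, EP) f w v) : EP) = fderiv ℝ g w v := by
    intro v
    have := mfderiv_comp w
      (mdifferentiableAt_extChartAt (I := 𝓘(ℝ, EP)) (mem_chart_source EP (f w)))
      (hfw.mdifferentiableAt (by simp))
    exact ((congrArg (fun T : W →L[ℝ] EP => T v) this).symm.trans
      (congrArg (fun T : W →L[ℝ] EP => T v) mfderiv_eq_fderiv))
  have hc' : fderiv ℝ (fun x => (chartForm η (f w) (φ (f x))).comp (fderiv ℝ g x)) w = _ :=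
    hc.fderiv
  -- the terms with the second derivative of `g` cancel by its symmetry
  simp only [extD]
  rw [hc', hch, hch]
  simp only [_root_.add_apply, ContinuousLinearMap.comp_apply,
    ContinuousLinearMap.compL_apply, ContinuousLinearMap.flip_apply, Function.comp_apply]
  rw [hsymm]
  abel

end ExteriorDerivative

/-! ### The derivative of a representation, and Cartan's formula -/

section Chart

variable {E : Type*} [NormedAddCommGroup E] [NormedSpace ℝ E]
  {N : Type*} [TopologicalSpace N] [ChartedSpace E N] [IsManifold 𝓘(ℝ, E) ∞ N]

theorem contMDiffAt_extChartAt_symm {q : N} {y : E} (hy : y ∈ (extChartAt 𝓘(ℝ, E) q).target) :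
    ContMDiffAt 𝓘(ℝ, E) 𝓘(ℝ, E) ∞ (extChartAt 𝓘(ℝ, E) q).symm y :=
  (contMDiffOn_extChartAt_symm q).contMDiffAt ((isOpen_extChartAt_target q).mem_nhds hy)

theorem hasMFDerivAt_extChartAt_symm_self (q : N) :
    HasMFDerivAt 𝓘(ℝ, E) 𝓘(ℝ, E) (extChartAt 𝓘(ℝ, E) q).symm (extChartAt 𝓘(ℝ, E) q q)
      (ContinuousLinearMap.id ℝ E) := by
  have h1 := ((contMDiffAt_extChartAt_symm
    (mem_extChartAt_target (I := 𝓘(ℝ, E)) q)).mdifferentiableAt (by simp)).hasMFDerivAt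
  have h2 := mfderivWithin_range_extChartAt_symm (I := 𝓘(ℝ, E)) (x := q)
  rw [modelWithCornersSelf_coe, Set.range_id, mfderivWithin_univ] at h2
  rw [h2] at h1
  exact h1

end Chart

section Representations

variable {EG : Type*} [NormedAddCommGroup EG] [NormedSpace ℝ EG]
  {G : Type*} [TopologicalSpace G] [ChartedSpace EG G] [Group G] [LieGroup 𝓘(ℝ, EG) ∞ G]
  {V : Type*} [NormedAddCommGroup V] [NormedSpace ℝ V]

/-- The infinitesimal representation is the derivative of `ρ` read in the chart at `1`. -/
theorem LieRep.hasFDerivAt_inf (r : LieRep EG G V) :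
    HasFDerivAt (fun x => r.ρ ((extChartAt 𝓘(ℝ, EG) (1 : G)).symm x)) r.inf
      (extChartAt 𝓘(ℝ, EG) (1 : G) 1) := by
  have h1 := hasMFDerivAt_extChartAt_symm_self (E := EG) (1 : G)
  have h2 : HasMFDerivAt 𝓘(ℝ, EG) 𝓘(ℝ, V →L[ℝ] V) (fun g => r.ρ g) (1 : G) r.inf :=
    (r.smooth.mdifferentiable (by simp) 1).hasMFDerivAt
  rw [← extChartAt_to_inv (I := 𝓘(ℝ, EG)) (1 : G)] at h2
  exact hasMFDerivAt_iff_hasFDerivAt.1 (h2.comp _ h1)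

theorem LieRep.hasFDerivAt_inv (r : LieRep EG G V) :
    HasFDerivAt (fun x => r.ρ ((extChartAt 𝓘(ℝ, EG) (1 : G)).symm x)⁻¹) (-r.inf)
      (extChartAt 𝓘(ℝ, EG) (1 : G) 1) := by
  set e := extChartAt 𝓘(ℝ, EG) (1 : G) 1 with he
  have h1 := r.hasFDerivAt_inf
  have hs : ContMDiff 𝓘(ℝ, EG) 𝓘(ℝ, V →L[ℝ] V) ∞ (fun g : G => r.ρ g⁻¹) :=
    r.smooth.comp (contMDiff_inv 𝓘(ℝ, EG) ∞)
  have h2 : DifferentiableAt ℝ (fun x => r.ρ ((extChartAt 𝓘(ℝ, EG) (1 : G)).symm x)⁻¹) e :=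
    ((contMDiffAt_iff_contDiffAt.1 ((hs _).comp _ (contMDiffAt_extChartAt_symm
      (mem_extChartAt_target (I := 𝓘(ℝ, EG)) (1 : G))))).differentiableAt (by simp))
  have h4 : fderiv ℝ (fun x => r.ρ ((extChartAt 𝓘(ℝ, EG) (1 : G)).symm x)⁻¹) e = -r.inf := by
    refine ContinuousLinearMap.ext fun a => ContinuousLinearMap.ext fun v => ?_
    -- differentiate `ρ(g) ρ(g⁻¹) v = v`
    have h3 := (h1.clm_apply (h2.hasFDerivAt.clm_apply (hasFDerivAt_const v e))).unique
      ((hasFDerivAt_const v e).congr_of_eventuallyEq (Filter.Eventually.of_forall fun x => by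
        change (r.ρ _ * r.ρ _) v = v
        rw [← map_mul, mul_inv_cancel, map_one]
        rfl))
    have h5 := congrArg (fun L : EG →L[ℝ] V => L a) h3
    rw [he, extChartAt_to_inv, inv_one, map_one] at h5
    rw [ContinuousLinearMap.comp_zero, zero_add] at h5
    exact eq_neg_of_add_eq_zero_left h5
  exact h4 ▸ h2.hasFDerivAt

end Representations

section Vertical

variable {EG : Type*} [NormedAddCommGroup EG] [NormedSpace ℝ EG] [FiniteDimensional ℝ EG]
  {G : Type*} [TopologicalSpace G] [ChartedSpace EG G] [Group G] [LieGroup 𝓘(ℝ, EG) ∞ G]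
  {EP : Type*} [NormedAddCommGroup EP] [NormedSpace ℝ EP] [FiniteDimensional ℝ EP]
  {P : Type*} [TopologicalSpace P] [ChartedSpace EP P] [IsManifold 𝓘(ℝ, EP) ∞ P]
  {EM : Type*} [NormedAddCommGroup EM] [NormedSpace ℝ EM]
  {M : Type*} [TopologicalSpace M] [ChartedSpace EM M]
  {Z : Type*} [NormedAddCommGroup Z] [NormedSpace ℝ Z]

/-- Cartan's formula `ι_{α†} dη = L_{α†} η - d(η(α†))` for an equivariant form `η` which is constant
on the fundamental vector field `α†`: the Lie derivative is minus the infinitesimal action of `α`,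
and the second term vanishes. -/
theorem PrincipalBundle.extD_fund (Q : PrincipalBundle EG G EP P EM M) {r : LieRep EG G Z}
    {η : OneForm EP P Z} (hη : SmoothForm η) (heq : Q.Equivariant r η) {α : EG} {z : Z}
    (hα : ∀ p, η p (Q.fund α p) = z) (p : P) (Y : TangentSpace 𝓘(ℝ, EP) p) :
    extD η p (Q.fund α p) Y = -r.inf α (η p Y) := by
  set φ := extChartAt 𝓘(ℝ, EP) p with hφ
  set γ := extChartAt 𝓘(ℝ, EG) (1 : G) with hγ
  -- `dη` is computed along the action map, read in the charts of `G` at `1` and of `P` at `p`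
  let f : EG × EP → P := fun w => Q.act (φ.symm w.2) (γ.symm w.1)
  let U : Set (EG × EP) := γ.target ×ˢ φ.target
  have hU : IsOpen U := (isOpen_extChartAt_target 1).prod (isOpen_extChartAt_target p)
  have hf : ContMDiffOn 𝓘(ℝ, EG × EP) 𝓘(ℝ, EP) ∞ f U := by
    have h1 : ContMDiffOn 𝓘(ℝ, EG × EP) 𝓘(ℝ, EP) ∞ (fun w : EG × EP => φ.symm w.2) U :=
      (contMDiffOn_extChartAt_symm p).comp contDiff_snd.contMDiff.contMDiffOn fun w hw => hw.2
    have h2 : ContMDiffOn 𝓘(ℝ, EG × EP) 𝓘(ℝ, EG) ∞ (fun w : EG × EP => γ.symm w.1) U :=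
      (contMDiffOn_extChartAt_symm 1).comp contDiff_fst.contMDiff.contMDiffOn fun w hw => hw.1
    exact Q.act_smooth.comp_contMDiffOn (h1.prodMk h2)
  let e : EG := γ 1
  have he : e ∈ γ.target := mem_extChartAt_target 1
  have hp : φ p ∈ φ.target := mem_extChartAt_target p
  have hγe : γ.symm e = 1 := extChartAt_to_inv 1
  have hφp : φ.symm (φ p) = p := extChartAt_to_inv p
  have hfd : ∀ w ∈ U, HasMFDerivAt 𝓘(ℝ, EG × EP) 𝓘(ℝ, EP) f w
      (mfderiv 𝓘(ℝ, EG × EP) 𝓘(ℝ, EP) f w) := fun w hw =>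
    ((hf.contMDiffAt (hU.mem_nhds hw)).mdifferentiableAt (by simp)).hasMFDerivAt
  have hleft : ∀ y : EP, HasFDerivAt (fun x : EG => (x, y)) (ContinuousLinearMap.inl ℝ EG EP) e :=
    fun y => hasFDerivAt_prodMk_left e y
  have hright : ∀ x : EG, ∀ y : EP, HasFDerivAt (fun y : EP => (x, y))
      (ContinuousLinearMap.inr ℝ EG EP) y :=
    fun x y => hasFDerivAt_prodMk_right x y
  have hdα : ∀ y ∈ φ.target, (mfderiv 𝓘(ℝ, EG × EP) 𝓘(ℝ, EP) f (e, y) ((α, 0) : EG × EP) : EP) =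
      Q.fund α (φ.symm y) := by
    intro y hy
    have h1 := (hfd (e, y) ⟨he, hy⟩).comp e (hasMFDerivAt_iff_hasFDerivAt.2 (hleft y))
    have h2 : HasMFDerivAt 𝓘(ℝ, EG) 𝓘(ℝ, EP) (fun g : G => Q.act (φ.symm y) g) 1
        (mfderiv 𝓘(ℝ, EG) 𝓘(ℝ, EP) (fun g : G => Q.act (φ.symm y) g) 1) :=
      ((Q.act_smooth.comp (contMDiff_const.prodMk contMDiff_id)).mdifferentiable
        (by simp) 1).hasMFDerivAt
    have h3 : HasMFDerivAt 𝓘(ℝ, EG) 𝓘(ℝ, EP) (fun g : G => Q.act (φ.symm y) g) (γ.symm e)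
        (mfderiv 𝓘(ℝ, EG) 𝓘(ℝ, EP) (fun g : G => Q.act (φ.symm y) g) 1 : EG →L[ℝ] EP) := by
      rw [hγe]; exact h2
    have h4 := h3.comp e (hasMFDerivAt_extChartAt_symm_self (1 : G))
    have h5 := hasMFDerivAt_unique h1 h4
    exact congrArg (fun L : EG →L[ℝ] EP => L α) h5
  have hdY : ∀ x ∈ γ.target, (mfderiv 𝓘(ℝ, EG × EP) 𝓘(ℝ, EP) f (x, φ p) ((0, Y) : EG × EP) : EP) =
      Q.transl (γ.symm x) p Y := by
    intro x hx
    have h1 := (hfd (x, φ p) ⟨hx, hp⟩).comp (φ p) (hasMFDerivAt_iff_hasFDerivAt.2 (hright x (φ p)))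
    have h2 : HasMFDerivAt 𝓘(ℝ, EP) 𝓘(ℝ, EP) (fun q : P => Q.act q (γ.symm x)) p
        (mfderiv 𝓘(ℝ, EP) 𝓘(ℝ, EP) (fun q : P => Q.act q (γ.symm x)) p) :=
      ((Q.act_smooth.comp (contMDiff_id.prodMk contMDiff_const)).mdifferentiable
        (by simp) p).hasMFDerivAt
    have h3 : HasMFDerivAt 𝓘(ℝ, EP) 𝓘(ℝ, EP) (fun q : P => Q.act q (γ.symm x)) (φ.symm (φ p))
        (mfderiv 𝓘(ℝ, EP) 𝓘(ℝ, EP) (fun q : P => Q.act q (γ.symm x)) p : EP →L[ℝ] EP) := by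
      rw [hφp]; exact h2
    have h4 := h3.comp (φ p) (hasMFDerivAt_extChartAt_symm_self p)
    have h5 := hasMFDerivAt_unique h1 h4
    exact congrArg (fun L : EP →L[ℝ] EP => L Y) h5
  -- evaluation of `η` does not depend on the expression of the base point
  have ht : ∀ q q' : P, q = q' → ∀ v w : EP, v = w →
      (η q : EP →L[ℝ] Z) v = (η q' : EP →L[ℝ] Z) w := by
    rintro _ _ rfl _ _ rfl; rfl
  have hFα : ∀ y ∈ φ.target, pullbackForm η f (e, y) (α, 0) = z := by
    intro y hy
    refine Eq.trans (ht _ _ ?_ _ _ (hdα y hy)) (hα (φ.symm y))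
    change Q.act (φ.symm y) (γ.symm e) = _
    rw [hγe, Q.act_one]
  have hFY : ∀ x ∈ γ.target, pullbackForm η f (x, φ p) (0, Y) = r.ρ (γ.symm x)⁻¹ (η p Y) := by
    intro x hx
    refine Eq.trans (ht _ _ ?_ _ _ (hdY x hx)) (heq (γ.symm x) p Y)
    change Q.act (φ.symm (φ p)) (γ.symm x) = _
    rw [hφp]
  have hw : ((e, φ p) : EG × EP) ∈ U := ⟨he, hp⟩
  have hF := (hη.differentiableAt_pullbackForm hU hf hw).hasFDerivAt
  have hd1 : fderiv ℝ (pullbackForm η f) (e, φ p) (α, 0) (0, Y) = -r.inf α (η p Y) := by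
    have h1 := (HasFDerivAt.comp e hF (hleft (φ p))).clm_apply
      (hasFDerivAt_const ((0, Y) : EG × EP) e)
    have h2 := r.hasFDerivAt_inv.clm_apply (hasFDerivAt_const (η p Y : Z) e)
    have h3 := h1.unique (h2.congr_of_eventuallyEq (by
      filter_upwards [(isOpen_extChartAt_target (I := 𝓘(ℝ, EG)) (1 : G)).mem_nhds he] with x hx
      exact hFY x hx))
    simpa using congrArg (fun L : EG →L[ℝ] Z => L α) h3
  have hd2 : fderiv ℝ (pullbackForm η f) (e, φ p) (0, Y) (α, 0) = 0 := by
    have h1 := (HasFDerivAt.comp (φ p) hF (hright e (φ p))).clm_apply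
      (hasFDerivAt_const ((α, 0) : EG × EP) (φ p))
    have h3 := h1.unique ((hasFDerivAt_const z (φ p)).congr_of_eventuallyEq (by
      filter_upwards [(isOpen_extChartAt_target (I := 𝓘(ℝ, EP)) p).mem_nhds hp] with y hy
      exact hFα y hy))
    rw [ContinuousLinearMap.comp_zero, zero_add] at h3
    exact congrArg (fun L : EP →L[ℝ] Z => L Y) h3
  have main := extD_mfderiv hη hU hf hw (α, 0) (0, Y)
  rw [hd1, hd2, sub_zero] at main
  have hT : ∀ q q' : P, q = q' → ∀ v v' w w' : EP, v = v' → w = w' →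
      extD η q' v' w' = extD η q v w := by
    rintro _ _ rfl _ _ _ _ rfl rfl; rfl
  have hfw : f (e, φ p) = p := by
    change Q.act (φ.symm (φ p)) (γ.symm e) = _
    rw [hφp, hγe, Q.act_one]
  refine Eq.trans (hT _ _ hfw _ _ _ _ ?_ ?_) main
  · refine (hdα (φ p) hp).trans ?_
    rw [hφp]
  · refine (hdY e he).trans ?_
    rw [hγe]
    change (mfderiv 𝓘(ℝ, EP) 𝓘(ℝ, EP) (fun q => Q.act q 1) p : EP →L[ℝ] EP) Y = Y
    have : (fun q => Q.act q 1) = id := funext Q.act_one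
    rw [this]
    exact congrArg (fun L : EP →L[ℝ] EP => L Y) mfderiv_id

end Vertical

/-! ### The adjoint representation and the Lie bracket -/

section AdjointBracket

variable {EG : Type*} [NormedAddCommGroup EG] [NormedSpace ℝ EG]
  {G : Type*} [TopologicalSpace G] [ChartedSpace EG G] [Group G] [LieGroup 𝓘(ℝ, EG) ∞ G]

variable (EG G) in
/-- The multiplication of `G` in the preferred chart at `1`, as a function on the whole model space;
it is meaningful near `(chartOne, chartOne)` only. -/
def chartMul (w : EG × EG) : EG :=
  extChartAt 𝓘(ℝ, EG) (1 : G) ((extChartAt 𝓘(ℝ, EG) (1 : G)).symm w.1 *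
    (extChartAt 𝓘(ℝ, EG) (1 : G)).symm w.2)

variable (EG G) in
/-- The unit of `G` in the preferred chart at `1`. -/
def chartOne : EG := extChartAt 𝓘(ℝ, EG) (1 : G) 1

theorem contDiffAt_chartMul : ContDiffAt ℝ ∞ (chartMul EG G) (chartOne EG G, chartOne EG G) := by
  have hm : chartOne EG G ∈ (extChartAt 𝓘(ℝ, EG) (1 : G)).target := mem_extChartAt_target 1
  have h0 : (extChartAt 𝓘(ℝ, EG) (1 : G)).symm (chartOne EG G) = 1 := extChartAt_to_inv 1
  have h1 : ContMDiffAt 𝓘(ℝ, EG × EG) 𝓘(ℝ, EG) ∞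
      (fun w : EG × EG => (extChartAt 𝓘(ℝ, EG) (1 : G)).symm w.1) (chartOne EG G, chartOne EG G) :=
    (contMDiffAt_extChartAt_symm hm).comp (chartOne EG G, chartOne EG G)
      contDiff_fst.contMDiff.contMDiffAt
  have h2 : ContMDiffAt 𝓘(ℝ, EG × EG) 𝓘(ℝ, EG) ∞
      (fun w : EG × EG => (extChartAt 𝓘(ℝ, EG) (1 : G)).symm w.2) (chartOne EG G, chartOne EG G) :=
    (contMDiffAt_extChartAt_symm hm).comp (chartOne EG G, chartOne EG G)
      contDiff_snd.contMDiff.contMDiffAt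
  have h3 : ContMDiffAt 𝓘(ℝ, EG) 𝓘(ℝ, EG) ∞ (extChartAt 𝓘(ℝ, EG) (1 : G))
      ((extChartAt 𝓘(ℝ, EG) (1 : G)).symm (chartOne EG G) *
        (extChartAt 𝓘(ℝ, EG) (1 : G)).symm (chartOne EG G)) := by
    rw [h0, one_mul]
    exact contMDiffAt_extChartAt
  exact contMDiffAt_iff_contDiffAt.1 (h3.comp (chartOne EG G, chartOne EG G) (h1.mul h2))

/-- In the chart, the left invariant vector field of `α` is the partial derivative of the
multiplication in the second variable. -/
theorem fderiv_chartMul_right {x : EG} (hx : x ∈ (extChartAt 𝓘(ℝ, EG) (1 : G)).target)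
    (hd : DifferentiableAt ℝ (chartMul EG G) (x, chartOne EG G)) (α : EG) :
    (mfderiv 𝓘(ℝ, EG) 𝓘(ℝ, EG) (extChartAt 𝓘(ℝ, EG) (1 : G)).symm x
      (fderiv ℝ (chartMul EG G) (x, chartOne EG G) (0, α)) : EG) =
    mulInvariantVectorField (I := 𝓘(ℝ, EG)) (G := G) α ((extChartAt 𝓘(ℝ, EG) (1 : G)).symm x) := by
  set φ := extChartAt 𝓘(ℝ, EG) (1 : G) with hφ
  set e := chartOne EG G with he
  have h0 : φ.symm e = 1 := extChartAt_to_inv 1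
  have hm : chartMul EG G (x, e) = x := by
    change φ (φ.symm x * φ.symm e) = x
    rw [h0, mul_one, φ.right_inv hx]
  have h1 : HasFDerivAt (fun y : EG => chartMul EG G (x, y)) _ e :=
    HasFDerivAt.comp (g := chartMul EG G) e hd.hasFDerivAt (hasFDerivAt_prodMk_right x e)
  have h2 := ((contMDiffAt_extChartAt_symm hx).mdifferentiableAt (by simp)).hasMFDerivAt
  have h3 : HasMFDerivAt 𝓘(ℝ, EG) 𝓘(ℝ, EG) φ.symm (chartMul EG G (x, e))
      (mfderiv 𝓘(ℝ, EG) 𝓘(ℝ, EG) φ.symm x : EG →L[ℝ] EG) := by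
    rw [hm]; exact h2
  have h4 := h3.comp e (hasMFDerivAt_iff_hasFDerivAt.2 h1)
  have h5 : HasMFDerivAt 𝓘(ℝ, EG) 𝓘(ℝ, EG) (fun h : G => φ.symm x * h) (φ.symm e)
      (mfderiv 𝓘(ℝ, EG) 𝓘(ℝ, EG) (fun h : G => φ.symm x * h) 1 : EG →L[ℝ] EG) := by
    rw [h0]
    exact ((contMDiff_mul_left (I := 𝓘(ℝ, EG)) (n := ∞)).mdifferentiable (by simp) 1).hasMFDerivAt
  have h6 := h5.comp e (hasMFDerivAt_extChartAt_symm_self (1 : G))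
  have hc : ContinuousAt (fun y => φ.symm x * φ.symm y) e :=
    h6.continuousAt
  have h7 : (φ.symm ∘ fun y : EG => chartMul EG G (x, y)) =ᶠ[nhds e]
      (fun h : G => φ.symm x * h) ∘ φ.symm := by
    have : φ.symm x * φ.symm e ∈ φ.source := by
      rw [h0, mul_one]; exact φ.map_target hx
    filter_upwards [hc.eventually ((isOpen_extChartAt_source (1 : G)).mem_nhds this)] with y hy
    exact φ.left_inv hy
  have h8 := hasMFDerivAt_unique h4 (h6.congr_of_eventuallyEq h7)
  exact congrArg (fun L : EG →L[ℝ] EG => L α) h8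

/-- The identity `(g h g⁻¹) g = g h`, differentiated in `h` at `1`, in the chart. -/
theorem fderiv_chartMul_adj {x : EG}
    (hd : DifferentiableAt ℝ (chartMul EG G) (x, chartOne EG G))
    (hd' : DifferentiableAt ℝ (chartMul EG G) (chartOne EG G, x)) (β : EG) :
    fderiv ℝ (chartMul EG G) (chartOne EG G, x)
      (adj ((extChartAt 𝓘(ℝ, EG) (1 : G)).symm x) β, 0) =
    fderiv ℝ (chartMul EG G) (x, chartOne EG G) (0, β) := by
  set φ := extChartAt 𝓘(ℝ, EG) (1 : G) with hφ
  set e := chartOne EG G with he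
  set g : G := φ.symm x with hg
  have h0 : φ.symm e = 1 := extChartAt_to_inv 1
  have hg1 : g * 1 * g⁻¹ = 1 := by simp
  have h1 : HasFDerivAt (fun y : EG => chartMul EG G (x, y)) _ e :=
    HasFDerivAt.comp (g := chartMul EG G) e hd.hasFDerivAt (hasFDerivAt_prodMk_right x e)
  have h2 : HasMFDerivAt 𝓘(ℝ, EG) 𝓘(ℝ, EG) (fun h : G => g * h * g⁻¹) (φ.symm e)
      (adj g : EG →L[ℝ] EG) := by
    rw [h0]
    exact ((contMDiff_conj_left EG G g).mdifferentiable (by simp) 1).hasMFDerivAt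
  have h3 := h2.comp e (hasMFDerivAt_extChartAt_symm_self (1 : G))
  have h4 : HasMFDerivAt 𝓘(ℝ, EG) 𝓘(ℝ, EG) φ (((fun h : G => g * h * g⁻¹) ∘ φ.symm) e)
      (ContinuousLinearMap.id ℝ EG) := by
    have : ((fun h : G => g * h * g⁻¹) ∘ φ.symm) e = 1 := by simp [h0]
    rw [this]
    have h5 := (mdifferentiableAt_extChartAt (I := 𝓘(ℝ, EG))
      (mem_chart_source EG (1 : G))).hasMFDerivAt
    rw [mfderiv_extChartAt_self] at h5
    exact h5
  have h5 : HasFDerivAt (fun y => φ (g * φ.symm y * g⁻¹)) (adj g : EG →L[ℝ] EG) e :=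
    hasMFDerivAt_iff_hasFDerivAt.1 (h4.comp e h3)
  have h6 : φ (g * φ.symm e * g⁻¹) = e := by rw [h0, hg1]; rfl
  have h7 : HasFDerivAt (chartMul EG G) (fderiv ℝ (chartMul EG G) (e, x))
      (φ (g * φ.symm e * g⁻¹), x) := by
    rw [h6]; exact hd'.hasFDerivAt
  have h8 : HasFDerivAt (fun y => chartMul EG G (φ (g * φ.symm y * g⁻¹), x)) _ e :=
    HasFDerivAt.comp (g := chartMul EG G) e h7 (h5.prodMk (hasFDerivAt_const x e))
  have h9 : (fun y => chartMul EG G (φ (g * φ.symm y * g⁻¹), x)) =ᶠ[nhds e]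
      fun y => chartMul EG G (x, y) := by
    have hs : g * φ.symm e * g⁻¹ ∈ φ.source := by
      rw [h0, hg1]; exact mem_extChartAt_source 1
    filter_upwards [h3.continuousAt.eventually ((isOpen_extChartAt_source (1 : G)).mem_nhds hs)]
      with y hy
    change φ (φ.symm (φ (g * φ.symm y * g⁻¹)) * g) = φ (g * φ.symm y)
    have hy' : φ.symm (φ (g * φ.symm y * g⁻¹)) = g * φ.symm y * g⁻¹ := φ.left_inv hy
    rw [hy', inv_mul_cancel_right]
  have h10 := h8.unique (h1.congr_of_eventuallyEq h9)
  exact congrArg (fun L : EG →L[ℝ] EG => L β) h10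

theorem fderiv_chartMul_left (z : EG) :
    fderiv ℝ (chartMul EG G) (chartOne EG G, chartOne EG G) (z, 0) = z := by
  set φ := extChartAt 𝓘(ℝ, EG) (1 : G) with hφ
  set e := chartOne EG G with he
  have h0 : φ.symm e = 1 := extChartAt_to_inv 1
  have hd : DifferentiableAt ℝ (chartMul EG G) (e, e) :=
    contDiffAt_chartMul.differentiableAt (by simp)
  have h1 : HasFDerivAt (fun y : EG => chartMul EG G (y, e)) _ e :=
    HasFDerivAt.comp (g := chartMul EG G) e hd.hasFDerivAt (hasFDerivAt_prodMk_left e e)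
  have h2 := h1.unique ((hasFDerivAt_id e).congr_of_eventuallyEq (by
    filter_upwards [(isOpen_extChartAt_target (I := 𝓘(ℝ, EG)) (1 : G)).mem_nhds
      (mem_extChartAt_target 1)] with y hy
    change φ (φ.symm y * φ.symm e) = y
    rw [h0, mul_one, φ.right_inv hy]))
  exact congrArg (fun L : EG →L[ℝ] EG => L z) h2

/-- The bracket of `𝔤` is the skew-symmetrization of the mixed second derivative of the
multiplication in a chart. -/
theorem lieBr_eq_fderiv_fderiv (α β : EG) :
    lieBr EG G α β =
      fderiv ℝ (fderiv ℝ (chartMul EG G)) (chartOne EG G, chartOne EG G) (α, 0) (0, β) -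
      fderiv ℝ (fderiv ℝ (chartMul EG G)) (chartOne EG G, chartOne EG G) (β, 0) (0, α) := by
  set φ := extChartAt 𝓘(ℝ, EG) (1 : G) with hφ
  set e := chartOne EG G with he
  have hμ : ContDiffAt ℝ 2 (chartMul EG G) (e, e) :=
    contDiffAt_chartMul.of_le (by exact ENat.LEInfty.out)
  have hdd : DifferentiableAt ℝ (fderiv ℝ (chartMul EG G)) (e, e) :=
    (hμ.fderiv_right (m := 1) (by norm_num)).differentiableAt (by simp)
  have hin : HasFDerivAt (fun x : EG => (x, e)) (ContinuousLinearMap.inl ℝ EG EG) e :=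
    hasFDerivAt_prodMk_left e e
  let R : EG → EG → EG := fun α =>
    VectorField.mpullbackWithin 𝓘(ℝ, EG) 𝓘(ℝ, EG) φ.symm
      (mulInvariantVectorField (I := 𝓘(ℝ, EG)) (G := G) α) Set.univ
  have hR : ∀ α, R α =ᶠ[nhds e] fun x => fderiv ℝ (chartMul EG G) (x, e) (0, α) := by
    intro α
    have h1 : ∀ᶠ x in nhds e, DifferentiableAt ℝ (chartMul EG G) (x, e) :=
      hin.continuousAt.eventually ((hμ.eventually (by simp)).mono fun w hw =>
        hw.differentiableAt (by simp))
    filter_upwards [h1, (isOpen_extChartAt_target (I := 𝓘(ℝ, EG)) (1 : G)).mem_nhds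
      (mem_extChartAt_target 1)] with x hxd hx
    have hinv := isInvertible_mfderivWithin_extChartAt_symm (I := 𝓘(ℝ, EG)) hx
    rw [modelWithCornersSelf_coe, Set.range_id] at hinv
    refine hinv.inverse_apply_eq.2 ?_
    rw [mfderivWithin_univ]
    exact (fderiv_chartMul_right hx hxd α).symm
  have hRd : ∀ α v, fderiv ℝ (R α) e v =
      fderiv ℝ (fderiv ℝ (chartMul EG G)) (e, e) (v, 0) (0, α) := by
    intro α v
    have h1 := (HasFDerivAt.comp (g := fderiv ℝ (chartMul EG G))
      (f := fun x : EG => (x, e)) e hdd.hasFDerivAt hin).clm_apply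
      (hasFDerivAt_const ((0, α) : EG × EG) e)
    rw [ContinuousLinearMap.comp_zero, zero_add] at h1
    rw [(h1.congr_of_eventuallyEq (hR α)).fderiv]
    rfl
  have hRe : ∀ α, R α e = α := by
    intro α
    have h2 := mfderivWithin_extChartAt_symm_inverse_apply (I := 𝓘(ℝ, EG)) (x := (1 : G)) α
    rw [modelWithCornersSelf_coe, Set.range_id] at h2
    refine Eq.trans ?_ h2
    refine congrArg (mfderivWithin 𝓘(ℝ, EG) 𝓘(ℝ, EG) φ.symm Set.univ e).inverse ?_
    have : ∀ g : G, g = 1 → (mulInvariantVectorField (I := 𝓘(ℝ, EG)) (G := G) α g : EG) = α := by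
      rintro _ rfl
      change (mfderiv 𝓘(ℝ, EG) 𝓘(ℝ, EG) (fun h : G => 1 * h) 1 : EG →L[ℝ] EG) α = α
      have h3 : (fun h : G => 1 * h) = id := by ext; simp
      rw [h3]
      exact congrArg (fun L : EG →L[ℝ] EG => L α) mfderiv_id
    exact this _ (extChartAt_to_inv 1)
  have hb : lieBr EG G α β = VectorField.lieBracket ℝ (R α) (R β) e := by
    unfold lieBr
    rw [← VectorField.mlieBracketWithin_univ, VectorField.mlieBracketWithin_apply]
    rw [modelWithCornersSelf_coe, Set.range_id, Set.preimage_univ, Set.univ_inter,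
      mfderiv_extChartAt_self]
    refine (congrArg (fun L : EG →L[ℝ] EG => L _) ContinuousLinearMap.inverse_id).trans ?_
    exact congrFun (VectorField.lieBracketWithin_univ (𝕜 := ℝ) (V := R α) (W := R β)) e
  rw [hb, VectorField.lieBracket, hRe, hRe, hRd, hRd]

/-- The infinitesimal adjoint representation is given by the Lie bracket.  With `μ` the
multiplication in a chart and `e` the unit, `∂₁μ(e, x) (Ad_x β) = ∂₂μ(x, e) β`; differentiate
this in `x` at `e` and use the symmetry of the second derivative of `μ`. -/
theorem adjRep_inf (α β : EG) : (adjRep : LieRep EG G EG).inf α β = lieBr EG G α β := by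
  set φ := extChartAt 𝓘(ℝ, EG) (1 : G) with hφ
  set e := chartOne EG G with he
  have hμ : ContDiffAt ℝ 2 (chartMul EG G) (e, e) :=
    contDiffAt_chartMul.of_le (by exact ENat.LEInfty.out)
  have hdd : DifferentiableAt ℝ (fderiv ℝ (chartMul EG G)) (e, e) :=
    (hμ.fderiv_right (m := 1) (by norm_num)).differentiableAt (by simp)
  have hin : HasFDerivAt (fun x : EG => (x, e)) (ContinuousLinearMap.inl ℝ EG EG) e :=
    hasFDerivAt_prodMk_left e e
  have hin' : HasFDerivAt (fun x : EG => (e, x)) (ContinuousLinearMap.inr ℝ EG EG) e :=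
    hasFDerivAt_prodMk_right e e
  have hd := (hμ.eventually (by simp)).mono fun w hw => hw.differentiableAt (by simp)
  have hadj : HasFDerivAt (fun x => (adj (φ.symm x) β : EG)) ((adjRep : LieRep EG G EG).inf.flip β)
      e := by
    have := (adjRep : LieRep EG G EG).hasFDerivAt_inf.clm_apply (hasFDerivAt_const β e)
    rw [ContinuousLinearMap.comp_zero, zero_add] at this
    exact this
  have h1 := (HasFDerivAt.comp (g := fderiv ℝ (chartMul EG G))
    (f := fun x : EG => (x, e)) e hdd.hasFDerivAt hin).clm_apply
    (hasFDerivAt_const ((0, β) : EG × EG) e)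
  have h2 := (HasFDerivAt.comp (g := fderiv ℝ (chartMul EG G))
    (f := fun x : EG => (e, x)) e hdd.hasFDerivAt hin').clm_apply
    (hadj.prodMk (hasFDerivAt_const (0 : EG) e))
  have h3 := h2.unique (h1.congr_of_eventuallyEq (by
    filter_upwards [hin.continuousAt.eventually hd, hin'.continuousAt.eventually hd] with x hx1 hx2
    exact fderiv_chartMul_adj hx1 hx2 β))
  have h4 := congrArg (fun L : EG →L[ℝ] EG => L α) h3
  rw [ContinuousLinearMap.comp_zero, zero_add] at h4
  have hadj1 : adj (φ.symm e) β = β := by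
    have : φ.symm e = 1 := extChartAt_to_inv 1
    rw [this, adj_one]; rfl
  have h5 : fderiv ℝ (chartMul EG G) (e, e) ((adjRep : LieRep EG G EG).inf α β, 0) +
      fderiv ℝ (fderiv ℝ (chartMul EG G)) (e, e) (0, α) (adj (φ.symm e) β, 0) =
      fderiv ℝ (fderiv ℝ (chartMul EG G)) (e, e) (α, 0) (0, β) := h4
  rw [fderiv_chartMul_left, hadj1] at h5
  have hs : fderiv ℝ (fderiv ℝ (chartMul EG G)) (e, e) (0, α) (β, 0) =
      fderiv ℝ (fderiv ℝ (chartMul EG G)) (e, e) (β, 0) (0, α) :=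
    hμ.isSymmSndFDerivAt (by simp) _ _
  rw [lieBr_eq_fderiv_fderiv, ← h5, hs, add_sub_cancel_right]

end AdjointBracket

/-! ### The form given by a connection and the tautological form -/

section FlatStructures

variable {n : ℕ}
  {EG : Type*} [NormedAddCommGroup EG] [NormedSpace ℝ EG]
  {G : Type*} [TopologicalSpace G] [ChartedSpace EG G] [Group G]
  {EP : Type*} [NormedAddCommGroup EP] [NormedSpace ℝ EP]
  {P : Type*} [TopologicalSpace P] [ChartedSpace EP P]
  {EM : Type*} [NormedAddCommGroup EM] [NormedSpace ℝ EM]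
  {M : Type*} [TopologicalSpace M]

/-- `dim P = dim M + dim G`, from a local trivialization. -/
theorem PrincipalBundle.finrank_eq [ChartedSpace EM M] (Q : PrincipalBundle EG G EP P EM M)
    (p : P) :
    Module.finrank ℝ EP = Module.finrank ℝ (EM × EG) := by
  obtain ⟨e, hx, h1, h2, -⟩ := Q.locally_trivial (Q.π p)
  have hp : p ∈ e.source := e.mem_source.2 hx
  have hd : e.toOpenPartialHomeomorph.MDifferentiable 𝓘(ℝ, EP) (𝓘(ℝ, EM).prod 𝓘(ℝ, EG)) :=
    ⟨h1.mdifferentiableOn (by simp), h2.mdifferentiableOn (by simp)⟩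
  have hb := hd.mfderiv_bijective hp
  let L : EP →L[ℝ] (EM × EG) :=
    mfderiv 𝓘(ℝ, EP) (𝓘(ℝ, EM).prod 𝓘(ℝ, EG)) e.toOpenPartialHomeomorph p
  exact (LinearEquiv.ofBijective (L : EP →ₗ[ℝ] EM × EG) hb).finrank_eq

variable [LieGroup 𝓘(ℝ, EG) ∞ G] [IsManifold 𝓘(ℝ, EP) ∞ P]
  [ChartedSpace (EuclideanSpace ℝ (Fin n)) M]
  [IsManifold 𝓘(ℝ, EuclideanSpace ℝ (Fin n)) ∞ M]
  {r : LieRep EG G (EuclideanSpace ℝ (Fin n))}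

namespace GStructure

variable (S : GStructure r EP P M) (c : PrincipalConnection S.Q)

theorem τ_horizontalLift (p : P) (v : EuclideanSpace ℝ (Fin n)) :
    c.τ p (S.horizontalLift c p v) = 0 :=
  (S.exists_horizontalLift c p v).choose_spec.1

theorem θ_horizontalLift (p : P) (v : EuclideanSpace ℝ (Fin n)) :
    S.θ p (S.horizontalLift c p v) = v :=
  (S.exists_horizontalLift c p v).choose_spec.2

/-- The form `(τ, θ)` with values in `𝔤 × ℝⁿ` assembled from a connection and the tautological
form. -/
def coframe : OneForm EP P (EG × EuclideanSpace ℝ (Fin n)) := fun p => (c.τ p).prod (S.θ p)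

theorem coframe_smooth : SmoothForm (S.coframe c) :=
  c.smooth.prodMk S.θ_smooth

theorem coframe_fund (α : EG) (p : P) : S.coframe c p (S.Q.fund α p) = (α, 0) :=
  Prod.ext (c.τ_fund α p) (S.θ_fund α p)

variable [FiniteDimensional ℝ EG]

theorem coframe_equivariant : S.Q.Equivariant (prodRep r) (S.coframe c) := fun g p X =>
  Prod.ext (c.equivariant g p X) (S.θ_equivariant g p X)

/-- The infinitesimal action on `𝔤 × ℝⁿ` is the bracket in the first component. -/
theorem prodRep_inf (α : EG) (z : EG × EuclideanSpace ℝ (Fin n)) :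
    (prodRep r).inf α z = ((lieAlg EG G).br α z.1, r.inf α z.2) := by
  have h1 := (prodRep r).hasFDerivAt_inf.clm_apply (hasFDerivAt_const z _)
  have h2 := ((adjRep : LieRep EG G EG).hasFDerivAt_inf.clm_apply (hasFDerivAt_const z.1 _)).prodMk
    (r.hasFDerivAt_inf.clm_apply (hasFDerivAt_const z.2 _))
  have h3 := congrArg (fun L => L α) (h1.unique h2)
  simp only [ContinuousLinearMap.comp_zero, zero_add] at h3
  refine Eq.trans h3 (Prod.ext ?_ rfl)
  exact adjRep_inf α z.1

variable [FiniteDimensional ℝ EP]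

/-- A connection and the tautological form trivialize the tangent bundle: `(τ, θ)` is onto, and
`dim P = dim M + dim G`. -/
theorem coframe_injective (p : P) : Function.Injective (S.coframe c p) := by
  let L' : EP →L[ℝ] (EG × EuclideanSpace ℝ (Fin n)) := S.coframe c p
  let L : EP →ₗ[ℝ] (EG × EuclideanSpace ℝ (Fin n)) := L'
  have hs : Function.Surjective L := by
    rintro ⟨α, v⟩
    refine ⟨(S.Q.fund α p + S.horizontalLift c p v : TangentSpace 𝓘(ℝ, EP) p), ?_⟩
    refine (map_add (S.coframe c p) _ _).trans ?_
    rw [S.coframe_fund]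
    refine Prod.ext ?_ ?_
    · exact (congrArg (α + ·) (S.τ_horizontalLift c p v)).trans (add_zero α)
    · exact (congrArg (0 + ·) (S.θ_horizontalLift c p v)).trans (zero_add v)
  have hd : Module.finrank ℝ EP = Module.finrank ℝ (EG × EuclideanSpace ℝ (Fin n)) := by
    rw [S.Q.finrank_eq p, Module.finrank_prod, Module.finrank_prod, add_comm]
  exact (LinearMap.injective_iff_surjective_of_finrank_eq_finrank hd).2 hs

theorem fund_add_horizontalLift (p : P) (X : TangentSpace 𝓘(ℝ, EP) p) :
    S.Q.fund (c.τ p X) p + S.horizontalLift c p (S.θ p X) = X := by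
  apply S.coframe_injective c p
  rw [map_add, S.coframe_fund]
  refine Prod.ext ?_ ?_
  · exact (congrArg (c.τ p X + ·) (S.τ_horizontalLift c p _)).trans (add_zero _)
  · exact (congrArg (0 + ·) (S.θ_horizontalLift c p _)).trans (zero_add _)

/-- The curvature of `(τ, θ)` in `𝔤 ⋉ 𝔨` is the pair formed by the curvature of `τ` and by the
torsion form corrected by the bracket of `𝔨`. -/
theorem curv_coframe (k : AlmostLieBracket (EuclideanSpace ℝ (Fin n))) (p : P)
    (X Y : TangentSpace 𝓘(ℝ, EP) p) :
    curv (semidirect r k) (S.coframe c) p X Y =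
      (curv (lieAlg EG G) c.τ p X Y, S.torsionForm c p X Y + k.br (S.θ p X) (S.θ p Y)) := by
  have h1 : extD c.τ p X Y = (extD (S.coframe c) p X Y).1 :=
    extD_clm_comp (S.coframe_smooth c) (ContinuousLinearMap.fst ℝ EG (EuclideanSpace ℝ (Fin n)))
      p X Y
  have h2 : extD S.θ p X Y = (extD (S.coframe c) p X Y).2 :=
    extD_clm_comp (S.coframe_smooth c) (ContinuousLinearMap.snd ℝ EG (EuclideanSpace ℝ (Fin n)))
      p X Y
  refine Prod.ext ?_ ?_
  · change _ + _ = extD c.τ p X Y + _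
    rw [h1]
    rfl
  · simp only [torsionForm]
    rw [h2]
    change (extD (S.coframe c) p X Y).2 + (k.br (S.θ p X) (S.θ p Y) +
      r.inf (c.τ p X) (S.θ p Y) - r.inf (c.τ p Y) (S.θ p X)) = _
    abel

/-- The curvature of `(τ, θ)` is horizontal, for any bracket on `ℝⁿ`: by equivariance,
`d(τ, θ)(α†, Y)` is minus the action of `α` on `(τ, θ)(Y)`, which is the bracket of `(α, 0)` with
`(τ, θ)(Y)` in `𝔤 ⋉ 𝔨`. -/
theorem curv_coframe_fund (k : AlmostLieBracket (EuclideanSpace ℝ (Fin n))) (α : EG) (p : P)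
    (Y : TangentSpace 𝓘(ℝ, EP) p) :
    curv (semidirect r k) (S.coframe c) p (S.Q.fund α p) Y = 0 := by
  have h := S.Q.extD_fund (S.coframe_smooth c) (S.coframe_equivariant c) (S.coframe_fund c α) p Y
  simp only [curv]
  rw [h, prodRep_inf, S.coframe_fund]
  simp [semidirect]

theorem exists_connection_of_isFlat {k : AlmostLieBracket (EuclideanSpace ℝ (Fin n))}
    (h : S.toCartanBundle.IsFlat (semidirectExtension r k)) :
    ∃ c : PrincipalConnection S.Q,
      (∀ (p : P) (v w : EuclideanSpace ℝ (Fin n)), S.curvature c p v w = 0) ∧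
      (∀ (p : P) (v w : EuclideanSpace ℝ (Fin n)), S.torsion c p v w = -k.br v w) := by
  obtain ⟨η, hη, hflat⟩ := h
  let c : PrincipalConnection S.Q :=
    { τ := fun p => (ContinuousLinearMap.fst ℝ EG (EuclideanSpace ℝ (Fin n))).comp (η p)
      smooth := hη.smooth.clm_comp _
      τ_fund := fun α p => congrArg Prod.fst (hη.η_fund ⟨α, rfl⟩ p)
      equivariant := fun g p X => congrArg Prod.fst (hη.equivariant g p X) }
  have hc : S.coframe c = η := by
    funext p
    exact ContinuousLinearMap.ext fun X => Prod.ext rfl (hη.lifts p X).symm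
  have hcurv : ∀ (p : P) (X Y : TangentSpace 𝓘(ℝ, EP) p),
      curv (semidirect r k) (S.coframe c) p X Y = 0 := by
    rw [hc]; exact hflat
  simp only [S.curv_coframe] at hcurv
  refine ⟨c, fun p v w => congrArg Prod.fst (hcurv p _ _), fun p v w => ?_⟩
  have h := congrArg Prod.snd (hcurv p (S.horizontalLift c p v) (S.horizontalLift c p w))
  simp only [S.θ_horizontalLift] at h
  exact eq_neg_of_add_eq_zero_left h

theorem isFlat_of_connection {k : AlmostLieBracket (EuclideanSpace ℝ (Fin n))}
    (hR : ∀ (p : P) (v w : EuclideanSpace ℝ (Fin n)), S.curvature c p v w = 0)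
    (hT : ∀ (p : P) (v w : EuclideanSpace ℝ (Fin n)), S.torsion c p v w = -k.br v w) :
    S.toCartanBundle.IsFlat (semidirectExtension r k) := by
  refine ⟨S.coframe c, ⟨S.coframe_smooth c, S.coframe_equivariant c,
    fun α p => S.coframe_fund c α p, fun p X => rfl⟩, fun p => ?_⟩
  refine curv_eq_zero_of_decomposition (semidirect r k) (S.coframe c) p
    (S.fund_add_horizontalLift c p) (fun X Y => S.curv_coframe_fund c k _ p Y) fun X Y => ?_
  rw [S.curv_coframe, S.θ_horizontalLift, S.θ_horizontalLift]
  refine Prod.ext (hR p _ _) ?_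
  exact eq_neg_iff_add_eq_zero.1 (hT p _ _)

end GStructure

end FlatStructures

end CartanBundles

end

theorem theorem3p33
    {n : ℕ}
    {EG : Type*} [NormedAddCommGroup EG] [NormedSpace ℝ EG] [FiniteDimensional ℝ EG]
    {G : Type*} [TopologicalSpace G] [ChartedSpace EG G] [Group G] [LieGroup 𝓘(ℝ, EG) ∞ G]
    {EP : Type*} [NormedAddCommGroup EP] [NormedSpace ℝ EP] [FiniteDimensional ℝ EP]
    {P : Type*} [TopologicalSpace P] [ChartedSpace EP P] [IsManifold 𝓘(ℝ, EP) ∞ P]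
    {M : Type*} [TopologicalSpace M] [ChartedSpace (EuclideanSpace ℝ (Fin n)) M]
    [IsManifold 𝓘(ℝ, EuclideanSpace ℝ (Fin n)) ∞ M]
    (r : CartanBundles.LieRep EG G (EuclideanSpace ℝ (Fin n)))
    (S : CartanBundles.GStructure r EP P M)
    (k : CartanBundles.AlmostLieBracket (EuclideanSpace ℝ (Fin n))) :
    S.toCartanBundle.IsFlat (CartanBundles.GStructure.semidirectExtension r k) ↔
      ∃ c : CartanBundles.PrincipalConnection S.Q,
        (∀ (p : P) (v w : EuclideanSpace ℝ (Fin n)), S.curvature c p v w = 0) ∧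
        (∀ (p : P) (v w : EuclideanSpace ℝ (Fin n)), S.torsion c p v w = -k.br v w) :=
  ⟨fun h => S.exists_connection_of_isFlat h, fun ⟨c, hR, hT⟩ => S.isFlat_of_connection c hR hT⟩
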